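/- **Setting.** Let $\alpha>0$ (coupling constant) and $\Lambda>0$ (ultraviolet cut-off), and write $\widehat f(k)=(2\pi)^{-3/2}\int_{\mathbb R^3}f(x)e^{-ik\cdot x}\,dx$. Let $$\mathfrak H_\Lambda=\{f\in L^2(\mathbb R^3,\mathbb C^4):\ \operatorname{supp}\widehat f\subset B(0,\Lambda)\},$$ let $D^0=-i\boldsymbol\alpha\cdot\nabla+\beta$ be the free Dirac operator (with the standard $4\times4$ Dirac matrices) restricted to $\mathfrak H_\Lambda$, $P^0_-=\chi_{(-\infty,0)}(D^0)$ and $P^0_+=1-P^0_-$. For an operator $A$ on $\mathfrak H_\Lambda$ put $A_{\pm\pm}=P^0_\pm AP^0_\pm$ and $\operatorname{tr}_0(A)=\operatorname{tr}(A_{++}+A_{--})$. Let $\mathfrak S_p$ denote the Schatten classes and $$\mathcal K=\{Q\in\mathfrak S_2(\mathfrak H_\Lambda):\ Q_{++},Q_{--}\in\mathfrak S_1(\mathfrak H_\Lambda),\ Q=Q^*,\ -P^0_-\le Q\le 1-P^0_-\}.$$ For $Q\in\mathcal K$ let $\rho_Q(x)=\operatorname{tr}_{\mathbb C^4}Q(x,x)$,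 where $Q(x,y)$ is the smooth $4\times 4$ matrix kernel of $Q$. Let $$\mathcal C=\Big\{f\in\mathscr S'(\mathbb R^3):\ \int_{\mathbb R^3}\frac{|\widehat f(k)|^2}{|k|^2}\,dk<\infty\Big\},\qquad D(f,g)=\int_{\mathbb R^3}\frac{\widehat f(k)\,\overline{\widehat g(k)}}{|k|^2}\,dk ,$$ and, for a real-valued $\nu\in\mathcal C$ and $Z>0$, $$\mathcal E^{Z\nu}(Q)=\operatorname{tr}_0(D^0Q)-\alpha D(\rho_Q,Z\nu)+\frac\alpha2D(\rho_Q,\rho_Q),\qquad E(Z)=\inf\{\mathcal E^{Z\nu}(Q):\ Q\in\mathcal K\}.$$ **Proposition 3.1.** Let $\alpha>0$ and $\Lambda>0$. Let $\nu\in\mathcal C\cap L^1(\mathbb R^3,\mathbb R)$ be such that $\int|\nu|=1$ and $q=\int\nu\ne0$. Then $$\limsup_{Z\to+\infty}\frac{E(Z)}{Z^{5/3}}\le-c_1\,\alpha\,\Lambda\,|q|^{5/3},\qquad c_1=2^{-23/3}\,3^{1/3}\,\pi^{-4/3}.$$ -/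

import Mathlib

open MeasureTheory FourierTransform Filter
open scoped InnerProductSpace ENNReal SchwartzMap

noncomputable section

namespace BDF

/-- Physical space `ℝ³`, with its Euclidean norm. -/
abbrev R3 := EuclideanSpace ℝ (Fin 3)

/-- Spinors: `ℂ⁴` with its Hermitian norm. -/
abbrev Spinor := EuclideanSpace ℂ (Fin 4)

/-- `L²(ℝ³, ℂ⁴)`. -/
abbrev L2 := Lp Spinor 2 (volume : Measure R3)

/-! ### The one-particle space with ultraviolet cut-off

Mathlib's Fourier transform is `𝓕 f (ξ) = ∫ f(x) e^{-2πi x·ξ} dx`, extended to a unitary map of `L²`.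
The physical momentum attached to the frequency `ξ` is `p = 2πξ`, and the transform with the
convention `(2π)^{-3/2} ∫ f(x) e^{-ip·x} dx` is `(2π)^{-3/2} 𝓕 f (p / 2π)`. -/

/-- The frequencies `ξ` whose momentum `p = 2πξ` lies in the ball of radius `Λ`. -/
def momentumBall (Λ : ℝ) : Set R3 := {ξ | ‖(2 * Real.pi) • ξ‖ ≤ Λ}

theorem momentumBall_eq (Λ : ℝ) :
    momentumBall Λ = Metric.closedBall (0 : R3) (Λ / (2 * Real.pi)) := by
  ext ξ
  have h : (0 : ℝ) < 2 * Real.pi := by positivity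
  simp only [momentumBall, Set.mem_ofPred_eq, Metric.mem_closedBall, dist_zero_right, norm_smul,
    Real.norm_of_nonneg h.le]
  rw [le_div_iff₀ h, mul_comm]

theorem isCompact_momentumBall (Λ : ℝ) : IsCompact (momentumBall Λ) := by
  rw [momentumBall_eq]; exact isCompact_closedBall _ _

theorem measurableSet_momentumBall (Λ : ℝ) : MeasurableSet (momentumBall Λ) :=
  (isCompact_momentumBall Λ).measurableSet

/-- A continuous matrix-valued symbol `m(p)`, restricted to momenta `|p| ≤ Λ`, as a bounded
function of the frequency. -/
def cutSymbol (Λ : ℝ) (m : R3 → Spinor →L[ℂ] Spinor) : R3 → Spinor →L[ℂ] Spinor :=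
  (momentumBall Λ).indicator fun ξ => m ((2 * Real.pi) • ξ)

theorem memLp_cutSymbol (Λ : ℝ) {m : R3 → Spinor →L[ℂ] Spinor} (hm : Continuous m) :
    MemLp (cutSymbol Λ m) ∞ (volume : Measure R3) := by
  have hc : Continuous fun ξ : R3 => m ((2 * Real.pi) • ξ) := by fun_prop
  obtain ⟨C, hC⟩ := (isCompact_momentumBall Λ).exists_bound_of_continuousOn hc.continuousOn
  refine memLp_top_of_bound
    (hc.aestronglyMeasurable.indicator (measurableSet_momentumBall Λ)) (max C 0)
    (ae_of_all _ fun ξ => ?_)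
  by_cases h : ξ ∈ momentumBall Λ
  · simpa [cutSymbol, h] using Or.inl (hC ξ h)
  · simp [cutSymbol, h]

/-- The Fourier multiplier `1_{|p| ≤ Λ} m(p)` on `L²(ℝ³, ℂ⁴)`. -/
def multiplier (Λ : ℝ) (m : R3 → Spinor →L[ℂ] Spinor) (hm : Continuous m) : L2 →L[ℂ] L2 :=
  ((Lp.fourierTransformₗᵢ R3 Spinor).symm.toContinuousLinearEquiv : L2 →L[ℂ] L2) ∘L
    ((ContinuousLinearMap.id ℂ (Spinor →L[ℂ] Spinor)).holderL volume ∞ 2 2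
      ((memLp_cutSymbol Λ hm).toLp _)) ∘L
    ((Lp.fourierTransformₗᵢ R3 Spinor).toContinuousLinearEquiv : L2 →L[ℂ] L2)

theorem fourier_multiplier (Λ : ℝ) (m : R3 → Spinor →L[ℂ] Spinor) (hm : Continuous m) (f : L2) :
    (𝓕 (multiplier Λ m hm f) : L2) =ᵐ[volume] fun ξ => cutSymbol Λ m ξ ((𝓕 f : L2) ξ) := by
  have h : (𝓕 (multiplier Λ m hm f) : L2) =
      (ContinuousLinearMap.id ℂ (Spinor →L[ℂ] Spinor)).holder 2
        ((memLp_cutSymbol Λ hm).toLp _) (𝓕 f : L2) :=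
    (Lp.fourierTransformₗᵢ R3 Spinor).apply_symm_apply _
  rw [h]
  filter_upwards [ContinuousLinearMap.coeFn_holder (r := 2)
    (ContinuousLinearMap.id ℂ (Spinor →L[ℂ] Spinor))
    ((memLp_cutSymbol Λ hm).toLp _) (𝓕 f : L2), (memLp_cutSymbol Λ hm).coeFn_toLp] with ξ h1 h2
  rw [h1, h2]; rfl

/-- `𝔥_Λ = {f ∈ L²(ℝ³, ℂ⁴) : supp f̂ ⊂ B(0, Λ)}`. -/
def cutoffSpace (Λ : ℝ) : Submodule ℂ L2 where
  carrier := {f | ∀ᵐ ξ : R3, Λ < ‖(2 * Real.pi) • ξ‖ → (𝓕 f : L2) ξ = 0}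
  zero_mem' := by
    have h : (𝓕 (0 : L2) : L2) = 0 := (Lp.fourierTransformₗᵢ R3 Spinor).map_zero
    simp only [Set.mem_ofPred_eq, h]
    filter_upwards [Lp.coeFn_zero Spinor 2 (volume : Measure R3)] with ξ h1 _
    exact h1
  add_mem' {f g} hf hg := by
    have h : (𝓕 (f + g) : L2) = 𝓕 f + 𝓕 g := (Lp.fourierTransformₗᵢ R3 Spinor).map_add f g
    simp only [Set.mem_ofPred_eq, h] at hf hg ⊢
    filter_upwards [hf, hg, Lp.coeFn_add (𝓕 f : L2) (𝓕 g)] with ξ h1 h2 h3 h4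
    rw [h3, Pi.add_apply, h1 h4, h2 h4, add_zero]
  smul_mem' c f hf := by
    have h : (𝓕 (c • f) : L2) = c • 𝓕 f := (Lp.fourierTransformₗᵢ R3 Spinor).map_smul c f
    simp only [Set.mem_ofPred_eq, h] at hf ⊢
    filter_upwards [hf, Lp.coeFn_smul c (𝓕 f : L2)] with ξ h1 h3 h4
    simp [h3, h1 h4]

theorem multiplier_mem (Λ : ℝ) (m : R3 → Spinor →L[ℂ] Spinor) (hm : Continuous m) (f : L2) :
    multiplier Λ m hm f ∈ cutoffSpace Λ := by
  change ∀ᵐ ξ : R3, _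
  filter_upwards [fourier_multiplier Λ m hm f] with ξ h1 h2
  have h3 : ξ ∉ momentumBall Λ := by simpa [momentumBall] using h2
  simp [h1, cutSymbol, h3]

theorem mem_cutoffSpace_iff (Λ : ℝ) (f : L2) :
    f ∈ cutoffSpace Λ ↔
      multiplier Λ (fun _ => ContinuousLinearMap.id ℂ Spinor) continuous_const f = f := by
  refine ⟨fun hf => ?_, fun h => h ▸ multiplier_mem _ _ _ _⟩
  apply (Lp.fourierTransformₗᵢ R3 Spinor).injective
  change (𝓕 (multiplier Λ (fun _ => ContinuousLinearMap.id ℂ Spinor) continuous_const f) : L2) =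
    𝓕 f
  apply Lp.ext
  change ∀ᵐ ξ : R3, _ at hf
  filter_upwards [hf, fourier_multiplier Λ (fun _ => ContinuousLinearMap.id ℂ Spinor)
    continuous_const f] with ξ h1 h2
  rw [h2]
  by_cases h : ξ ∈ momentumBall Λ
  · simp [cutSymbol, h]
  · have : Λ < ‖(2 * Real.pi) • ξ‖ := by simpa [momentumBall] using h
    simp [h1 this]

instance instCompleteSpaceCutoffSpace (Λ : ℝ) : CompleteSpace (cutoffSpace Λ) := by
  have h : IsClosed (cutoffSpace Λ : Set L2) := by
    have : (cutoffSpace Λ : Set L2) =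
        {f | multiplier Λ (fun _ => ContinuousLinearMap.id ℂ Spinor) continuous_const f = f} := by
      ext f; exact mem_cutoffSpace_iff Λ f
    rw [this]
    exact isClosed_eq (ContinuousLinearMap.continuous _) continuous_id
  exact h.completeSpace_coe

/-- Bounded operators on `𝔥_Λ`. -/
abbrev Op (Λ : ℝ) := cutoffSpace Λ →L[ℂ] cutoffSpace Λ

/-! ### The free Dirac operator -/

/-- The Dirac matrices `α₁, α₂, α₃`. -/
def diracAlpha : Fin 3 → Matrix (Fin 4) (Fin 4) ℂ :=
  ![!![0, 0, 0, 1; 0, 0, 1, 0; 0, 1, 0, 0; 1, 0, 0, 0],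
    !![0, 0, 0, -Complex.I; 0, 0, Complex.I, 0; 0, -Complex.I, 0, 0; Complex.I, 0, 0, 0],
    !![0, 0, 1, 0; 0, 0, 0, -1; 1, 0, 0, 0; 0, -1, 0, 0]]

/-- The Dirac matrix `β`. -/
def diracBeta : Matrix (Fin 4) (Fin 4) ℂ := Matrix.diagonal ![1, 1, -1, -1]

/-- The symbol `D⁰(p) = α·p + β` of the free Dirac operator `-iα·∇ + β`. -/
def diracSymbol (p : R3) : Spinor →L[ℂ] Spinor :=
  Matrix.toEuclideanCLM (n := Fin 4) (𝕜 := ℂ) ((∑ i, (p i : ℂ) • diracAlpha i) + diracBeta)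

theorem continuous_diracSymbol : Continuous diracSymbol := by
  have h : Continuous (Matrix.toEuclideanCLM (n := Fin 4) (𝕜 := ℂ)) :=
    LinearMap.continuous_of_finiteDimensional
      (Matrix.toEuclideanCLM (n := Fin 4) (𝕜 := ℂ)).toAlgEquiv.toLinearMap
  unfold diracSymbol
  refine h.comp ?_
  fun_prop

/-- The free Dirac operator `D⁰` restricted to `𝔥_Λ`. -/
def freeDirac (Λ : ℝ) : Op Λ :=
  ((multiplier Λ diracSymbol continuous_diracSymbol) ∘L (cutoffSpace Λ).subtypeL).codRestrict
    (cutoffSpace Λ) fun f => multiplier_mem Λ diracSymbol continuous_diracSymbol f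

theorem fourier_freeDirac (Λ : ℝ) (f : cutoffSpace Λ) :
    (𝓕 (freeDirac Λ f : L2) : L2) =ᵐ[volume]
      fun ξ => diracSymbol ((2 * Real.pi) • ξ) ((𝓕 (f : L2) : L2) ξ) := by
  have hf : ∀ᵐ ξ : R3, Λ < ‖(2 * Real.pi) • ξ‖ → (𝓕 (f : L2) : L2) ξ = 0 := f.2
  filter_upwards [hf, fourier_multiplier Λ diracSymbol continuous_diracSymbol f] with ξ h1 h2
  change (𝓕 (multiplier Λ diracSymbol continuous_diracSymbol f) : L2) ξ = _
  rw [h2]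
  by_cases h : ξ ∈ momentumBall Λ
  · simp [cutSymbol, h]
  · have : Λ < ‖(2 * Real.pi) • ξ‖ := by simpa [momentumBall] using h
    simp [h1 this]

/-! ### Spectral projections, Schatten classes and traces -/

section Hilbert

variable {H : Type*} [NormedAddCommGroup H] [InnerProductSpace ℂ H] [CompleteSpace H]

/-- The spectral projection `χ_{(-∞,0)}(D)` of a self-adjoint operator `D` with a gap around `0` in
its spectrum (so that the indicator function is continuous on the spectrum). -/
def negProj (D : H →L[ℂ] H) : H →L[ℂ] H := cfc (Set.indicator (Set.Iio (0 : ℝ)) (1 : ℝ → ℝ)) D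

variable (H) in
/-- The index set of a fixed orthonormal Hilbert basis of `H`. -/
def basisSet : Set H := (exists_hilbertBasis ℂ H).choose

variable (H) in
/-- A fixed orthonormal Hilbert basis of `H`. -/
def basis : HilbertBasis (basisSet H) ℂ H := (exists_hilbertBasis ℂ H).choose_spec.choose

/-- The trace `∑ᵢ ⟨eᵢ, A eᵢ⟩` of a trace-class operator (it does not depend on the basis). -/
def trace (A : H →L[ℂ] H) : ℂ := ∑' i, ⟪basis H i, A (basis H i)⟫_ℂ

/-- The Schatten class `𝔖_p` for an integer `p ≥ 1`: `tr(|A|^p) < ∞`, where `|A| = (A* A)^{1/2}`. -/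
def IsSchatten (p : ℕ) (A : H →L[ℂ] H) : Prop :=
  Summable fun i => (⟪basis H i, (CFC.abs A ^ p) (basis H i)⟫_ℂ).re

/-- `𝔖_{1,P}` for a projection `P = P₋`, with `P₊ = 1 - P`: the Hilbert-Schmidt operators `Q` whose
diagonal blocks `Q₊₊ = P₊ Q P₊` and `Q₋₋ = P₋ Q P₋` are trace class. -/
def IsGenTraceClass (P Q : H →L[ℂ] H) : Prop :=
  IsSchatten 2 Q ∧ IsSchatten 1 ((1 - P) * Q * (1 - P)) ∧ IsSchatten 1 (P * Q * P)

/-- The generalized trace `tr₀(A) = tr(A₊₊ + A₋₋)`. -/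
def genTrace (P A : H →L[ℂ] H) : ℂ := trace ((1 - P) * A * (1 - P) + P * A * P)

/-- `{Q ∈ 𝔖_{1,P} : Q = Q*, -P ≤ Q ≤ 1 - P}`, where `≤` is the order of quadratic forms. -/
def convexSet (P : H →L[ℂ] H) : Set (H →L[ℂ] H) :=
  {Q | IsGenTraceClass P Q ∧ IsSelfAdjoint Q ∧ -P ≤ Q ∧ Q ≤ 1 - P}

end Hilbert

/-- The free Dirac sea `P⁰₋ = χ_{(-∞,0)}(D⁰)` on `𝔥_Λ`. The spectrum of `D⁰` does not meet
`(-1, 1)`. -/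
def Pminus (Λ : ℝ) : Op Λ := negProj (freeDirac Λ)

/-- The variational set
`𝒦 = {Q ∈ 𝔖_{1,P⁰₋}(𝔥_Λ) : Q = Q*, -P⁰₋ ≤ Q ≤ 1 - P⁰₋}`. -/
def variationalSet (Λ : ℝ) : Set (Op Λ) := convexSet (Pminus Λ)

/-! ### The density of an operator on `𝔥_Λ` -/

theorem memLp_planeWave (Λ : ℝ) (x : R3) (j : Fin 4) :
    MemLp ((momentumBall Λ).indicator fun ξ : R3 =>
      Complex.exp (-(2 * Real.pi * ⟪ξ, x⟫_ℝ : ℝ) * Complex.I) • EuclideanSpace.single j (1 : ℂ))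
      2 (volume : Measure R3) := by
  have hc : Continuous fun ξ : R3 =>
      Complex.exp (-(2 * Real.pi * ⟪ξ, x⟫_ℝ : ℝ) * Complex.I) •
        (EuclideanSpace.single j (1 : ℂ) : Spinor) := by fun_prop
  rw [memLp_indicator_iff_restrict (measurableSet_momentumBall Λ)]
  have : IsFiniteMeasure ((volume : Measure R3).restrict (momentumBall Λ)) :=
    ⟨by simpa using (isCompact_momentumBall Λ).measure_lt_top⟩
  refine MemLp.of_bound hc.aestronglyMeasurable 1 (ae_of_all _ fun ξ => ?_)
  rw [norm_smul, ← Complex.ofReal_neg, Complex.norm_exp_ofReal_mul_I]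
  simp

/-- `Π_Λ (δ_x ⊗ e_j) ∈ 𝔥_Λ`, the band-limited Dirac mass at `x` with spinor index `j`: the function
whose Fourier transform is `e^{-2πi ξ·x} e_j` on the ball of momenta `|2πξ| ≤ Λ` and `0` outside. -/
def bandDelta (Λ : ℝ) (x : R3) (j : Fin 4) : cutoffSpace Λ :=
  ⟨(𝓕⁻ ((memLp_planeWave Λ x j).toLp _ : L2) : L2), by
    change ∀ᵐ ξ : R3, _
    have h : (𝓕 (𝓕⁻ ((memLp_planeWave Λ x j).toLp _ : L2) : L2) : L2) =
      (memLp_planeWave Λ x j).toLp _ := (Lp.fourierTransformₗᵢ R3 Spinor).apply_symm_apply _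
    rw [h]
    filter_upwards [(memLp_planeWave Λ x j).coeFn_toLp] with ξ h1 h2
    have h3 : ξ ∉ momentumBall Λ := by simpa [momentumBall] using h2
    rw [h1, Set.indicator_of_notMem h3]⟩

/-- On integrable `L²` functions the inverse Fourier transform is given by the integral formula. -/
theorem fourierInv_ae_eq (h : L2) (hi : Integrable (h : R3 → Spinor) volume) :
    (𝓕⁻ h : L2) =ᵐ[volume] 𝓕⁻ (h : R3 → Spinor) := by
  have hcont : Continuous (𝓕⁻ (h : R3 → Spinor)) := by
    rw [Real.fourierInv_eq_fourier_comp_neg]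
    exact VectorFourier.fourierIntegral_continuous Real.continuous_fourierChar continuous_inner hi.comp_neg
  refine ae_eq_of_integral_contDiff_smul_eq
    ((Lp.memLp (𝓕⁻ h : L2)).locallyIntegrable (by norm_num)) hcont.locallyIntegrable ?_
  intro g hg hs
  have hs' : HasCompactSupport (fun x => (g x : ℂ)) := hs.comp_left (g := fun x : ℝ => (x : ℂ)) (by simp)
  have hg' : ContDiff ℝ (⊤ : ℕ∞) (fun x => (g x : ℂ)) := Complex.ofRealCLM.contDiff.comp hg
  set φ : 𝓢(R3, ℂ) := hs'.toSchwartzMap hg' with hφ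
  have hφx : ∀ x, φ x = (g x : ℂ) := fun x => rfl
  have e1 := congrArg (fun T : 𝓢'(R3, Spinor) => T φ) (Lp.fourierInv_toTemperedDistribution_eq h)
  simp only [TemperedDistribution.fourierInv_apply, Lp.toTemperedDistribution_apply] at e1
  have e2 : ∫ ξ, (𝓕⁻ φ : 𝓢(R3, ℂ)) ξ • h ξ = ∫ x, φ x • (𝓕⁻ (h : R3 → Spinor)) x := by
    rw [SchwartzMap.fourierInv_coe]
    have hflip : (-innerₗ R3).flip = -innerₗ R3 := by
      ext a b; simp [real_inner_comm]
    have e := VectorFourier.integral_fourierIntegral_smul_eq_flip (L := -innerₗ R3)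
      Real.continuous_fourierChar (continuous_inner (𝕜 := ℝ) (E := R3)).neg
      (φ.integrable (μ := volume)) hi
    rw [hflip] at e
    exact e
  rw [e2] at e1
  simp only [hφx, Complex.coe_smul] at e1
  exact e1.symm

/-- `bandDelta` represents point evaluation on `𝔥_Λ`: `⟨δ_x ⊗ e_j, f⟩ = f(x)_j`. -/
theorem inner_bandDelta (Λ : ℝ) (f : cutoffSpace Λ) (j : Fin 4) :
    ∀ᵐ x : R3, ⟪bandDelta Λ x j, f⟫_ℂ = (f : L2) x j := by
  set h : L2 := 𝓕 (f : L2) with hh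
  have hf : ∀ᵐ ξ : R3, Λ < ‖(2 * Real.pi) • ξ‖ → h ξ = 0 := f.2
  have hfin : IsFiniteMeasure ((volume : Measure R3).restrict (momentumBall Λ)) :=
    ⟨by simpa using (isCompact_momentumBall Λ).measure_lt_top⟩
  have hae : (momentumBall Λ).indicator (h : R3 → Spinor) =ᵐ[volume] h := by
    filter_upwards [hf] with ξ h1
    by_cases h2 : ξ ∈ momentumBall Λ
    · simp [h2]
    · have : Λ < ‖(2 * Real.pi) • ξ‖ := by simpa [momentumBall] using h2
      simp [h2, h1 this]
  have hi : Integrable (h : R3 → Spinor) volume := by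
    refine Integrable.congr ?_ hae
    rw [integrable_indicator_iff (measurableSet_momentumBall Λ)]
    exact ((Lp.memLp h).restrict _).integrable (by norm_num)
  have hinv : (𝓕⁻ h : L2) = f := (Lp.fourierTransformₗᵢ R3 Spinor).symm_apply_apply _
  have key := fourierInv_ae_eq h hi
  rw [hinv] at key
  filter_upwards [key] with x hx
  rw [hx]
  have e1 : ⟪bandDelta Λ x j, f⟫_ℂ = ⟪((memLp_planeWave Λ x j).toLp _ : L2), h⟫_ℂ := by
    have e : (𝓕 (bandDelta Λ x j : L2) : L2) = (memLp_planeWave Λ x j).toLp _ :=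
      (Lp.fourierTransformₗᵢ R3 Spinor).apply_symm_apply _
    rw [← e, hh, Lp.inner_fourier_eq]; rfl
  rw [e1, L2.inner_def, Real.fourierInv_eq']
  have hI : Integrable (fun v : R3 =>
      Complex.exp ((2 * Real.pi * ⟪v, x⟫_ℝ : ℝ) * Complex.I) • h v) volume := by
    have hc : Continuous fun v : R3 => Complex.exp ((2 * Real.pi * ⟪v, x⟫_ℝ : ℝ) * Complex.I) := by
      fun_prop
    refine hi.bdd_smul 1 hc.aestronglyMeasurable (ae_of_all _ fun ξ => ?_)
    rw [Complex.norm_exp_ofReal_mul_I]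
  have e3 := ContinuousLinearMap.integral_comp_comm (EuclideanSpace.proj j : Spinor →L[ℂ] ℂ) hI
  change _ = (EuclideanSpace.proj j : Spinor →L[ℂ] ℂ) _
  rw [← e3]
  apply integral_congr_ae
  filter_upwards [hf, (memLp_planeWave Λ x j).coeFn_toLp] with ξ h1 h2
  rw [h2]
  by_cases h3 : ξ ∈ momentumBall Λ
  · rw [Set.indicator_of_mem h3, inner_smul_left, EuclideanSpace.inner_single_left, ← Complex.exp_conj]
    simp [-mul_eq_mul_right_iff, map_ofNat]
  · have : Λ < ‖(2 * Real.pi) • ξ‖ := by simpa [momentumBall] using h3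
    simp [h3, h1 this]

/-- The smooth `4 × 4` matrix kernel `Q(x, y)_{jk} = ⟨δ_x ⊗ e_j, Q (δ_y ⊗ e_k)⟩` of an operator `Q`
on `𝔥_Λ`. -/
def kernel {Λ : ℝ} (Q : Op Λ) (x y : R3) : Matrix (Fin 4) (Fin 4) ℂ :=
  Matrix.of fun j k => ⟪bandDelta Λ x j, Q (bandDelta Λ y k)⟫_ℂ

/-- `kernel Q` is the integral kernel of `Q`: `(Q f)(x) = ∫ Q(x, y) f(y) dy`. -/
theorem apply_eq_integral_kernel {Λ : ℝ} (Q : Op Λ) (f : cutoffSpace Λ) (j : Fin 4) :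
    ∀ᵐ x : R3, (Q f : L2) x j = ∫ y, (kernel Q x y).mulVec ((f : L2) y) j := by
  filter_upwards [inner_bandDelta Λ (Q f) j] with x hx
  rw [← hx, ← ContinuousLinearMap.adjoint_inner_left, Submodule.coe_inner, L2.inner_def]
  apply integral_congr_ae
  have hA := fun k => inner_bandDelta Λ ((ContinuousLinearMap.adjoint Q) (bandDelta Λ x j)) k
  filter_upwards [ae_all_iff.2 hA] with y hy
  simp only [kernel, Matrix.mulVec, dotProduct, Matrix.of_apply, PiLp.inner_apply]
  refine Finset.sum_congr rfl fun k _ => ?_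
  rw [← hy k, ContinuousLinearMap.adjoint_inner_right, ← inner_conj_symm]
  simp [mul_comm]

/-- The density `ρ_Q(x) = tr_{ℂ⁴} Q(x, x)`. -/
def density {Λ : ℝ} (Q : Op Λ) (x : R3) : ℂ := (kernel Q x x).trace

/-! ### Coulomb space and Coulomb energy -/

/-- The Fourier transform `f̂(k) = (2π)^{-3/2} ∫ f(x) e^{-ik·x} dx` of an integrable function. -/
def hat (f : R3 → ℂ) (k : R3) : ℂ :=
  ((2 * Real.pi) ^ (-(3 / 2) : ℝ) : ℝ) * ∫ x, f x * Complex.exp (-(⟪k, x⟫_ℝ : ℝ) * Complex.I)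

/-- The function `g` is the Fourier transform of the function `f` in the sense of tempered
distributions: `∫ g φ = ∫ f φ̂` for all Schwartz functions `φ`. -/
def IsFourierTransform (f g : R3 → ℂ) : Prop :=
  AEStronglyMeasurable f volume ∧ AEStronglyMeasurable g volume ∧
    ∀ φ : 𝓢(R3, ℂ), Integrable (fun x => f x * hat φ x) ∧ Integrable (fun k => g k * φ k) ∧
      ∫ k, g k * φ k = ∫ x, f x * hat φ x

/-- The function `f` belongs to the Coulomb space: its distributional Fourier transform is a function
`f̂` with `∫ |f̂(k)|² / |k|² dk < ∞`. -/
def MemCoulomb (f : R3 → ℂ) : Prop :=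
  ∃ g, IsFourierTransform f g ∧ ∫⁻ k, ENNReal.ofReal (‖g k‖ ^ 2 / ‖k‖ ^ 2) < ∞

open Classical in
/-- The distributional Fourier transform of `f` when it is a function; it is then unique almost
everywhere (otherwise a dummy value). -/
def fourierFun (f : R3 → ℂ) : R3 → ℂ :=
  if h : ∃ g, IsFourierTransform f g then h.choose else 0

/-- The Coulomb inner product `D(f, g) = ∫ |k|⁻² f̂(k) conj(ĝ(k)) dk`. -/
def coulomb (f g : R3 → ℂ) : ℂ :=
  ∫ k, fourierFun f k * (starRingEnd ℂ) (fourierFun g k) / (‖k‖ ^ 2 : ℝ)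

/-! ### The reduced Bogoliubov-Dirac-Fock energy -/

/-- The energy `tr₀(D⁰ Q) - α D(ρ_Q, ν) + (α/2) D(ρ_Q, ρ_Q)`, for an external density `ν`. For
`Q ∈ 𝒦` and real-valued `ν` every term is real. -/
def energy (α Λ : ℝ) (ν : R3 → ℝ) (Q : Op Λ) : ℝ :=
  (genTrace (Pminus Λ) (freeDirac Λ * Q)).re - α * (coulomb (density Q) fun x => (ν x : ℂ)).re
    + α / 2 * (coulomb (density Q) (density Q)).re

/-- The ground state energy `E(Z) = inf {ℰ^{Zν}(Q) : Q ∈ 𝒦}`, as an extended real number. -/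
def groundEnergy (α Λ : ℝ) (ν : R3 → ℝ) (Z : ℝ) : EReal :=
  ⨅ Q ∈ variationalSet Λ, (energy α Λ (fun x => Z * ν x) Q : EReal)

end BDF

end

/-! The bound is variational: one family of states suffices. Fill every momentum below the cut-off,
in a region of size `R`, with electrons if `q > 0` or with positrons if `q < 0`. With `P` the
projection on positive or negative energies and `s` a Gaussian, the state is `±P s² P = ±S*S`, where
`S = sP`. It is admissible because `S` is a Hilbert-Schmidt contraction with `SP = S` (`IsTrial`).

Its density is, up to sign, the convolution of `s²` with the squared convolution kernel of `P`
(`density_localOp`). That kernel has total mass `ρ = Λ³/(3π²)`: the symbol of `P` has rank 2, and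
the volume of frequencies is `Λ³/(6π²)` (`integral_profile`). For `s²` a Gaussian of width `R`, the
kinetic energy is at most of order `R³`. The attraction is `α Z R²` times a quantity tending to
`ρ|q|` (`tendsto_attraction`). The repulsion is at most `(α/2) · 2π^{3/2} ρ² R⁵`
(`coulomb_smear_self_le`).

With `R = a Z^{1/3}` both Coulomb terms scale as `Z^{5/3}` and the kinetic term only as `Z`. The
limit of the upper bound is `-α(a² ρ|q| - π^{3/2} a⁵ ρ²)`. Taking `a = (|q|/ρ)^{1/3}/4` gives a
multiple of `αΛ|q|^{5/3}` with room to spare over the stated constant (`constant_bound`). -/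

noncomputable section

namespace BDF

/-! ### Negative spectral projection as `(1 - sign D)/2` -/

section Hilbert

variable {H : Type*} [NormedAddCommGroup H] [InnerProductSpace ℂ H] [CompleteSpace H]

/-- The data identify `A` with `|D|` by uniqueness of the positive square root, `B` with a left
inverse of `|D|`, hence `C` with `sign D`. This turns the functional calculus into algebra that can
be checked on symbols. -/
theorem negProj_eq {D A B C : H →L[ℂ] H} (hsa : IsSelfAdjoint D)
    (hu : IsUnit D) (hA : 0 ≤ A) (hAD : A * A = D * D) (hB : B * A = 1)
    (hC : B * D = C) :
    negProj D = (1 / 2 : ℂ) • ((1 : H →L[ℂ] H) + (-1 : ℂ) • C) := by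
  subst hC
  have hB : B * CFC.abs D = 1 := by
    rwa [show CFC.abs D = A from CFC.sqrt_unique (by rw [hAD, hsa.star_eq]) hA]
  have hne : ∀ x ∈ spectrum ℝ D, x ≠ 0 := fun x hx h0 =>
    (spectrum.zero_notMem_iff ℝ).2 hu (h0 ▸ hx)
  set g : ℝ → ℝ := Set.indicator (Set.Iio (0 : ℝ)) (1 : ℝ → ℝ) with hg
  -- Invertibility of `D` keeps `0`, the only jump of the indicator, out of the spectrum.
  have hgc : ContinuousOn g (spectrum ℝ D) := by
    intro x hx
    apply ContinuousAt.continuousWithinAt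
    rcases lt_or_gt_of_ne (hne x hx) with h | h
    · refine (continuousAt_const (y := (1 : ℝ))).congr ?_
      filter_upwards [Iio_mem_nhds h] with y hy
      simp [g, Set.mem_Iio.1 hy]
    · refine (continuousAt_const (y := (0 : ℝ))).congr ?_
      filter_upwards [Ioi_mem_nhds h] with y hy
      simp [g, (Set.mem_Ioi.1 hy).le]
  -- On the spectrum `|x|(1 - 2·1_{x<0}) = x`; cancelling `|D|` on the left then isolates `sign D`.
  have key : CFC.abs D * (1 - (2 : ℝ) • cfc g D) = D := by
    have e1 : CFC.abs D = cfc (fun x : ℝ => ‖x‖) D := CFC.abs_eq_cfc_norm D hsa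
    have e2 : (1 : H →L[ℂ] H) - (2 : ℝ) • cfc g D = cfc (fun x => 1 - (2 : ℝ) • g x) D := by
      rw [cfc_sub (fun _ => (1 : ℝ)) (fun x => (2 : ℝ) • g x) D, cfc_const_one ℝ D,
        cfc_smul (2 : ℝ) g D]
    rw [e1, e2, ← cfc_mul (fun x : ℝ => ‖x‖) (fun x => 1 - (2 : ℝ) • g x) D]
    conv_rhs => rw [← cfc_id ℝ D]
    apply cfc_congr
    intro x hx
    rcases lt_or_gt_of_ne (hne x hx) with h | h
    · simp [g, h, abs_of_neg h]; ring
    · simp [g, h.le, abs_of_pos h]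
  have h3 : B * D = 1 - (2 : ℝ) • cfc g D := by
    conv_lhs => rw [← key, ← mul_assoc, hB, one_mul]
  change cfc g D = _
  rw [h3, ← Complex.coe_smul]
  push_cast
  module

theorem half_one_add_mul_self {A : Type*} [Ring A] [Algebra ℂ A] {s : A} (hs : s * s = 1) {e : ℂ}
    (he : e * e = 1) : ((1 / 2 : ℂ) • (1 + e • s)) * ((1 / 2 : ℂ) • (1 + e • s)) =
      (1 / 2 : ℂ) • (1 + e • s) := by
  simp only [smul_mul_smul_comm, add_mul, mul_add, one_mul, mul_one, hs, he]
  module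

theorem half_one_add_one {A : Type*} [Ring A] [Algebra ℂ A] (s : A) :
    (1 / 2 : ℂ) • (1 + (1 : ℂ) • s) = 1 - (1 / 2 : ℂ) • (1 + (-1 : ℂ) • s) := by
  module

theorem commute_half_one_add {A : Type*} [Ring A] [Algebra ℂ A] {s d : A} (h : d * s = s * d)
    (e : ℂ) : d * ((1 / 2 : ℂ) • (1 + e • s)) = ((1 / 2 : ℂ) • (1 + e • s)) * d := by
  simp [mul_add, add_mul, h]

end Hilbert

/-! ### Fourier multipliers as a star-algebra homomorphism -/

/-- Continuous matrix-valued symbols. -/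
abbrev Sym := C(R3, Spinor →L[ℂ] Spinor)

set_option synthInstance.maxHeartbeats 400000 in
instance : Ring Sym := inferInstance

set_option synthInstance.maxHeartbeats 400000 in
instance : Algebra ℂ Sym := inferInstance

set_option synthInstance.maxHeartbeats 400000 in
instance : StarRing Sym := inferInstance

instance : Monoid Sym := (inferInstance : Ring Sym).toMonoid

instance : Semigroup Sym := (inferInstance : Monoid Sym).toSemigroup

instance : AddCommGroup Sym := (inferInstance : Ring Sym).toAddCommGroup

instance : AddZeroClass Sym := (inferInstance : Ring Sym).toAddCommGroup.toAddMonoid.toAddZeroClass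

instance : MulOneClass Sym := (inferInstance : Monoid Sym).toMulOneClass

instance : NonUnitalNonAssocRing Sym := (inferInstance : Ring Sym).toNonUnitalRing.toNonUnitalNonAssocRing

instance : NonUnitalRing Sym := (inferInstance : Ring Sym).toNonUnitalRing

instance : NonUnitalNonAssocSemiring Sym :=
  (inferInstance : NonUnitalNonAssocRing Sym).toNonUnitalNonAssocSemiring

instance : NonUnitalSemiring Sym := (inferInstance : NonUnitalRing Sym).toNonUnitalSemiring

instance : Semiring Sym := (inferInstance : Ring Sym).toSemiring

instance : Module ℂ Sym := (inferInstance : Algebra ℂ Sym).toModule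

instance : IsScalarTower ℂ Sym Sym := IsScalarTower.right

instance : SMulCommClass ℂ Sym Sym := Algebra.to_smulCommClass

instance : AddMonoid Sym := (inferInstance : Ring Sym).toAddCommGroup.toAddMonoid

instance : Neg Sym := (inferInstance : Ring Sym).toNeg

instance : Distrib Sym := (inferInstance : Ring Sym).toDistrib

theorem ext_fourier {Λ : ℝ} {f g : cutoffSpace Λ}
    (h : (𝓕 (f : L2) : L2) =ᵐ[volume] (𝓕 (g : L2) : L2)) : f = g :=
  Subtype.ext ((Lp.fourierTransformₗᵢ R3 Spinor).injective (Lp.ext h))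

/-- The Fourier multiplier with continuous symbol `m`, as an operator on `𝔥_Λ`. -/
def multOp (Λ : ℝ) (m : Sym) : Op Λ :=
  ((multiplier Λ m m.continuous) ∘L (cutoffSpace Λ).subtypeL).codRestrict
    (cutoffSpace Λ) fun f => multiplier_mem Λ m m.continuous f

theorem fourier_multOp (Λ : ℝ) (m : Sym) (f : cutoffSpace Λ) :
    (𝓕 (multOp Λ m f : L2) : L2) =ᵐ[volume]
      fun ξ => m ((2 * Real.pi) • ξ) ((𝓕 (f : L2) : L2) ξ) := by
  have hf : ∀ᵐ ξ : R3, Λ < ‖(2 * Real.pi) • ξ‖ → (𝓕 (f : L2) : L2) ξ = 0 := f.2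
  filter_upwards [hf, fourier_multiplier Λ m m.continuous f] with ξ h1 h2
  change (𝓕 (multiplier Λ m m.continuous f) : L2) ξ = _
  rw [h2]
  by_cases h : ξ ∈ momentumBall Λ
  · simp [cutSymbol, h]
  · have : Λ < ‖(2 * Real.pi) • ξ‖ := by simpa [momentumBall] using h
    simp [h1 this]

/-- Together with the unit, sum, scalar and adjoint rules below, this reduces every operator
identity between multipliers to a pointwise identity of 4×4 matrices. -/
theorem multOp_mul (Λ : ℝ) (m n : Sym) :
    multOp Λ (m * n) = multOp Λ m * multOp Λ n := by
  ext1 f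
  apply ext_fourier
  filter_upwards [fourier_multOp Λ (m * n) f, fourier_multOp Λ m (multOp Λ n f),
    fourier_multOp Λ n f] with ξ h1 h2 h3
  rw [h1, mul_apply_eq_comp, h2, h3]
  rfl

theorem multOp_one (Λ : ℝ) : multOp Λ 1 = 1 := by
  ext1 f
  apply ext_fourier
  filter_upwards [fourier_multOp Λ 1 f] with ξ h1
  rw [h1]
  rfl

theorem multOp_add (Λ : ℝ) (m n : Sym) :
    multOp Λ (m + n) = multOp Λ m + multOp Λ n := by
  ext1 f
  apply ext_fourier
  have h : (𝓕 (((multOp Λ m + multOp Λ n) f : cutoffSpace Λ) : L2) : L2) =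
      𝓕 (multOp Λ m f : L2) + 𝓕 (multOp Λ n f : L2) :=
    (Lp.fourierTransformₗᵢ R3 Spinor).map_add _ _
  rw [h]
  filter_upwards [fourier_multOp Λ (m + n) f, fourier_multOp Λ m f, fourier_multOp Λ n f,
    Lp.coeFn_add (𝓕 (multOp Λ m f : L2) : L2) (𝓕 (multOp Λ n f : L2))] with ξ h1 h2 h3 h4
  rw [h1, h4, Pi.add_apply, h2, h3]
  rfl

theorem multOp_smul (Λ : ℝ) (c : ℂ) (m : Sym) :
    multOp Λ (c • m) = c • multOp Λ m := by
  ext1 f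
  apply ext_fourier
  have h : (𝓕 (((c • multOp Λ m) f : cutoffSpace Λ) : L2) : L2) = c • 𝓕 (multOp Λ m f : L2) :=
    (Lp.fourierTransformₗᵢ R3 Spinor).map_smul _ _
  rw [h]
  filter_upwards [fourier_multOp Λ (c • m) f, fourier_multOp Λ m f,
    Lp.coeFn_smul c (𝓕 (multOp Λ m f : L2) : L2)] with ξ h1 h2 h4
  rw [h1, h4, Pi.smul_apply, h2]
  rfl

theorem inner_eq_integral_fourier {Λ : ℝ} (f g : cutoffSpace Λ) :
    ⟪f, g⟫_ℂ = ∫ ξ, ⟪(𝓕 (f : L2) : L2) ξ, (𝓕 (g : L2) : L2) ξ⟫_ℂ := by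
  rw [Submodule.coe_inner, ← Lp.inner_fourier_eq, L2.inner_def]

theorem multOp_star (Λ : ℝ) (m : Sym) :
    multOp Λ (star m) = star (multOp Λ m) := by
  rw [ContinuousLinearMap.star_eq_adjoint, ContinuousLinearMap.eq_adjoint_iff]
  intro f g
  rw [inner_eq_integral_fourier, inner_eq_integral_fourier]
  apply integral_congr_ae
  filter_upwards [fourier_multOp Λ (star m) f, fourier_multOp Λ m g] with ξ h1 h2
  rw [h1, h2, ContinuousMap.star_apply, ContinuousLinearMap.star_eq_adjoint,
    ContinuousLinearMap.adjoint_inner_left]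

/-! ### Sign and spectral projections of the free Dirac operator -/

/-- The symbol of the free Dirac operator. -/
def diracSym : Sym := ⟨diracSymbol, continuous_diracSymbol⟩

theorem freeDirac_eq (Λ : ℝ) : freeDirac Λ = multOp Λ diracSym := rfl

/-- The scalar symbol attached to a continuous real function. -/
def scalarSym (φ : R3 → ℝ) (hφ : Continuous φ) : Sym :=
  ⟨fun p => (φ p : ℂ) • 1, by fun_prop⟩

theorem star_scalarSym (φ : R3 → ℝ) (hφ : Continuous φ) :
    star (scalarSym φ hφ) = scalarSym φ hφ := by
  ext1 p
  simp [scalarSym, star_smul]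

theorem scalarSym_mul_comm (φ : R3 → ℝ) (hφ : Continuous φ) (m : Sym) :
    scalarSym φ hφ * m = m * scalarSym φ hφ := by
  ext1 p
  simp [scalarSym]

theorem star_diracSym : star diracSym = diracSym := by
  ext1 p
  simp only [ContinuousMap.star_apply, diracSym, ContinuousMap.coe_mk, diracSymbol]
  rw [← map_star]
  congr 1
  ext i j
  fin_cases i <;> fin_cases j <;>
    simp [Matrix.star_apply, Fin.sum_univ_three, diracAlpha, diracBeta]

/-- The Dirac matrices square to one and anticommute pairwise, so all cross terms cancel; here the
sixteen entries are checked one by one. -/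
theorem diracMatrix_sq (p : R3) :
    ((∑ i, (p i : ℂ) • diracAlpha i) + diracBeta) * ((∑ i, (p i : ℂ) • diracAlpha i) + diracBeta) =
      ((1 + ‖p‖ ^ 2 : ℝ) : ℂ) • (1 : Matrix (Fin 4) (Fin 4) ℂ) := by
  rw [EuclideanSpace.norm_sq_eq]
  ext i j
  fin_cases i <;> fin_cases j <;>
    simp [Matrix.mul_apply, Fin.sum_univ_succ, diracAlpha, diracBeta] <;>
    ring_nf <;> simp

/-- The relativistic energy `√(1 + |p|²)`. -/
def relEnergy (p : R3) : ℝ := √(1 + ‖p‖ ^ 2)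

theorem relEnergy_pos (p : R3) : 0 < relEnergy p := Real.sqrt_pos.2 (by positivity)

theorem relEnergy_sq (p : R3) : relEnergy p ^ 2 = 1 + ‖p‖ ^ 2 := Real.sq_sqrt (by positivity)

theorem continuous_relEnergy : Continuous relEnergy := by unfold relEnergy; fun_prop

theorem continuous_relEnergy_inv : Continuous fun p => (relEnergy p)⁻¹ :=
  continuous_relEnergy.inv₀ fun p => (relEnergy_pos p).ne'

theorem diracSymbol_mul_self (p : R3) :
    diracSymbol p * diracSymbol p = ((relEnergy p ^ 2 : ℝ) : ℂ) • 1 := by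
  rw [diracSymbol, ← map_mul, diracMatrix_sq, map_smul, map_one, relEnergy_sq]

/-- The symbol `D⁰(p) / √(1 + |p|²)` of the sign of the free Dirac operator. -/
def signSym : Sym := scalarSym _ continuous_relEnergy_inv * diracSym

theorem signSym_apply (p : R3) : signSym p = ((relEnergy p)⁻¹ : ℂ) • diracSymbol p := by
  simp [signSym, scalarSym, diracSym]

theorem star_signSym : star signSym = signSym := by
  rw [signSym, star_mul, star_scalarSym, star_diracSym, scalarSym_mul_comm]

theorem signSym_mul_self : signSym * signSym = 1 := by
  ext1 p
  have h : (relEnergy p : ℂ) ≠ 0 := by exact_mod_cast (relEnergy_pos p).ne'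
  rw [ContinuousMap.mul_apply, signSym_apply, smul_mul_smul_comm, diracSymbol_mul_self, smul_smul]
  have : (relEnergy p : ℂ)⁻¹ * (relEnergy p : ℂ)⁻¹ * ((relEnergy p ^ 2 : ℝ) : ℂ) = 1 := by
    push_cast; field_simp
  rw [this, one_smul]
  rfl

theorem scalarSym_mul_signSym : scalarSym _ continuous_relEnergy * signSym = diracSym := by
  ext1 p
  have h : (relEnergy p : ℂ) ≠ 0 := by exact_mod_cast (relEnergy_pos p).ne'
  rw [ContinuousMap.mul_apply, signSym_apply]
  simp [scalarSym, diracSym, smul_smul, h]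

/-- The symbol `√φ` is again continuous and self-adjoint, so the operator factors as `B*B`. -/
theorem multOp_scalarSym_nonneg (Λ : ℝ) (φ : R3 → ℝ) (hφ : Continuous φ) (h0 : ∀ p, 0 ≤ φ p) :
    0 ≤ multOp Λ (scalarSym φ hφ) := by
  have h : scalarSym φ hφ =
      star (scalarSym (fun p => √(φ p)) (by fun_prop)) * scalarSym (fun p => √(φ p)) (by fun_prop) := by
    rw [star_scalarSym]
    ext1 p
    have : ((√(φ p) : ℝ) : ℂ) * ((√(φ p) : ℝ) : ℂ) = (φ p : ℂ) := by
      rw [← Complex.ofReal_mul, Real.mul_self_sqrt (h0 p)]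
    simp [scalarSym, smul_smul, this]
  rw [h, multOp_mul, multOp_star]
  rw [ContinuousLinearMap.nonneg_iff_isPositive]
  exact ContinuousLinearMap.isPositive_adjoint_comp_self _

theorem isSelfAdjoint_freeDirac (Λ : ℝ) : IsSelfAdjoint (freeDirac Λ) := by
  rw [IsSelfAdjoint, freeDirac_eq, ← multOp_star, star_diracSym]

theorem scalarSym_relEnergy_sq :
    scalarSym _ continuous_relEnergy * scalarSym _ continuous_relEnergy = diracSym * diracSym := by
  rw [← scalarSym_mul_signSym]
  set A : Sym := scalarSym _ continuous_relEnergy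
  calc A * A = A * A * (signSym * signSym) := by rw [signSym_mul_self, mul_one]
    _ = A * (A * signSym) * signSym := by simp only [mul_assoc]
    _ = A * (signSym * A) * signSym := by rw [scalarSym_mul_comm _ _ signSym]
    _ = A * signSym * (A * signSym) := by simp only [mul_assoc]

theorem scalarSym_inv_mul :
    scalarSym _ continuous_relEnergy_inv * scalarSym _ continuous_relEnergy = 1 := by
  ext1 p
  have h : (relEnergy p : ℂ) ≠ 0 := by exact_mod_cast (relEnergy_pos p).ne'
  rw [ContinuousMap.mul_apply]
  simp [scalarSym, smul_smul, h]

/-- The inverse has symbol `D⁰(p)/(1 + |p|²)`, written as the inverse energy times the sign. -/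
theorem isUnit_freeDirac (Λ : ℝ) : IsUnit (freeDirac Λ) := by
  set A : Sym := scalarSym _ continuous_relEnergy
  set B : Sym := scalarSym _ continuous_relEnergy_inv
  have h1 : diracSym * (B * signSym) = 1 := by
    rw [← scalarSym_mul_signSym, scalarSym_mul_comm, mul_assoc, ← mul_assoc A,
      scalarSym_mul_comm _ _ B, scalarSym_inv_mul, one_mul, signSym_mul_self]
  have h2 : (B * signSym) * diracSym = 1 := by
    rw [← scalarSym_mul_signSym, scalarSym_mul_comm _ continuous_relEnergy signSym]
    calc B * signSym * (signSym * A) = B * (signSym * signSym) * A := by simp only [mul_assoc]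
      _ = 1 := by rw [signSym_mul_self, mul_one, scalarSym_inv_mul]
  rw [freeDirac_eq]
  exact ⟨⟨multOp Λ diracSym, multOp Λ (B * signSym), by rw [← multOp_mul, h1, multOp_one],
    by rw [← multOp_mul, h2, multOp_one]⟩, rfl⟩

/-- The symbol of the spectral projection of `D⁰` on energies of sign `ε`. -/
def projSym (ε : ℝ) : Sym :=
  (1 / 2 : ℂ) • ((1 : Sym) + (ε : ℂ) • signSym)

theorem multOp_projSym (Λ ε : ℝ) :
    multOp Λ (projSym ε) = (1 / 2 : ℂ) • ((1 : Op Λ) + (ε : ℂ) • multOp Λ signSym) := by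
  rw [projSym, multOp_smul, multOp_add, multOp_one, multOp_smul]

theorem multOp_mul_eq_one {Λ : ℝ} {m n : Sym} (h : m * n = 1) : multOp Λ m * multOp Λ n = 1 := by
  rw [← multOp_mul, h, multOp_one]

/-- Multiplication by `√(1 + |p|²)` is positive and has the same square as `D⁰`, hence is `|D⁰|`;
the abstract formula then gives the symbol explicitly. -/
theorem projSym_neg_one (Λ : ℝ) : multOp Λ (projSym (-1)) = Pminus Λ := by
  have h1 : multOp Λ (scalarSym _ continuous_relEnergy_inv) *
      multOp Λ (scalarSym _ continuous_relEnergy) = 1 := multOp_mul_eq_one scalarSym_inv_mul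
  have h2 : multOp Λ (scalarSym _ continuous_relEnergy) *
      multOp Λ (scalarSym _ continuous_relEnergy) = freeDirac Λ * freeDirac Λ := by
    rw [freeDirac_eq, ← multOp_mul, ← multOp_mul, scalarSym_relEnergy_sq]
  have h3 : multOp Λ (scalarSym _ continuous_relEnergy_inv) * freeDirac Λ = multOp Λ signSym := by
    rw [freeDirac_eq, signSym, multOp_mul]
  rw [multOp_projSym, Complex.ofReal_neg, Complex.ofReal_one]
  exact (negProj_eq (isSelfAdjoint_freeDirac Λ) (isUnit_freeDirac Λ)
      (multOp_scalarSym_nonneg Λ _ continuous_relEnergy fun p => (relEnergy_pos p).le) h2 h1 h3).symm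

theorem projSym_one (Λ : ℝ) : multOp Λ (projSym 1) = 1 - Pminus Λ := by
  have h1 := multOp_projSym Λ 1
  have h2 := multOp_projSym Λ (-1)
  rw [projSym_neg_one] at h2
  rw [h1, h2, Complex.ofReal_neg, Complex.ofReal_one]
  exact half_one_add_one _

theorem star_projSym (ε : ℝ) : star (projSym ε) = projSym ε := by
  rw [projSym, star_smul, star_add, star_smul, star_signSym, star_one]
  simp

theorem projSym_mul_self {ε : ℝ} (hε : ε ^ 2 = 1) : projSym ε * projSym ε = projSym ε :=
  half_one_add_mul_self signSym_mul_self (by exact_mod_cast (by rw [← sq, hε] : ε * ε = 1))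

theorem diracSym_mul_projSym (ε : ℝ) : diracSym * projSym ε = projSym ε * diracSym := by
  refine commute_half_one_add ?_ _
  rw [signSym, scalarSym_mul_comm, mul_assoc, scalarSym_mul_comm]

/-- The symbol has trace `2`. -/
theorem sum_norm_projSym {ε : ℝ} (hε : ε ^ 2 = 1) (p : R3) :
    ∑ j : Fin 4, ‖projSym ε p (EuclideanSpace.single j 1)‖ ^ 2 = 2 := by
  -- For an orthogonal projection `M`, `‖Mv‖² = ⟪v, Mv⟫`, so the sum is the trace of `M`.
  have h1 : ∀ v : Spinor, ((‖projSym ε p v‖ ^ 2 : ℝ) : ℂ) = ⟪v, projSym ε p v⟫_ℂ := by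
    intro v
    have e1 : star (projSym ε p) = projSym ε p := congrArg (fun m => m p) (star_projSym ε)
    have e2 : projSym ε p * projSym ε p = projSym ε p :=
      congrArg (fun m => m p) (projSym_mul_self hε)
    rw [ContinuousLinearMap.star_eq_adjoint] at e1
    have e3 : projSym ε p v = projSym ε p (projSym ε p v) := by
      conv_lhs => rw [← e2]
      rfl
    rw [e3, ← ContinuousLinearMap.adjoint_inner_left, e1, ← e3, inner_self_eq_norm_sq_to_K]
    simp
  -- The Dirac matrices are traceless, so only half the trace of the 4×4 identity survives.
  have h2 : ∑ j : Fin 4, ⟪(EuclideanSpace.single j 1 : Spinor),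
      projSym ε p (EuclideanSpace.single j 1)⟫_ℂ = 2 := by
    simp only [projSym, ContinuousMap.smul_apply, ContinuousMap.add_apply, ContinuousMap.one_apply,
      signSym_apply]
    have e : ∀ j, ⟪(EuclideanSpace.single j 1 : Spinor),
        diracSymbol p (EuclideanSpace.single j 1)⟫_ℂ =
        ((∑ i, (p i : ℂ) • diracAlpha i) + diracBeta) j j := by
      intro j
      rw [diracSymbol, EuclideanSpace.inner_single_left]
      simp [Matrix.mulVec_single, Matrix.sum_apply]
    simp only [_root_.smul_apply, _root_.add_apply, inner_smul_right,
      inner_add_right, e]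
    simp [Fin.sum_univ_succ, diracAlpha, diracBeta]
    ring
  have h3 : ((∑ j : Fin 4, ‖projSym ε p (EuclideanSpace.single j 1)‖ ^ 2 : ℝ) : ℂ) = (2 : ℝ) := by
    rw [Complex.ofReal_sum]
    simp only [h1]
    rw [h2]; simp
  exact_mod_cast h3

/-! ### Admissibility and kinetic energy of the states `±S*S` -/

section Trial

variable {H K : Type*} [NormedAddCommGroup H] [InnerProductSpace ℂ H] [CompleteSpace H]
  [NormedAddCommGroup K] [InnerProductSpace ℂ K] [CompleteSpace K]

theorem isPositive_adjoint_comp (S : H →L[ℂ] K) :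
    0 ≤ ContinuousLinearMap.adjoint S ∘L S := by
  rw [ContinuousLinearMap.nonneg_iff_isPositive]
  exact ContinuousLinearMap.isPositive_adjoint_comp_self S

theorem isSchatten_neg {p : ℕ} {A : H →L[ℂ] H} (h : IsSchatten p A) : IsSchatten p (-A) := by
  simpa only [IsSchatten, CFC.abs_neg] using h

theorem isSchatten_one_zero : IsSchatten 1 (0 : H →L[ℂ] H) := by
  simp [IsSchatten, summable_zero]

theorem isSchatten_one_adjoint_comp {S : H →L[ℂ] K}
    (hS : Summable fun i => ‖S (basis H i)‖ ^ 2) :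
    IsSchatten 1 (ContinuousLinearMap.adjoint S ∘L S) := by
  rw [IsSchatten, CFC.abs_of_nonneg _ (isPositive_adjoint_comp S)]
  refine hS.congr fun i => ?_
  rw [pow_one, ContinuousLinearMap.comp_apply, ContinuousLinearMap.adjoint_inner_right,
    inner_self_eq_norm_sq_to_K]
  norm_cast

/-- Since `S*` is bounded, `‖S*S eᵢ‖ ≤ ‖S*‖ ‖S eᵢ‖`, and the right side is square summable. -/
theorem isSchatten_two_adjoint_comp {S : H →L[ℂ] K}
    (hS : Summable fun i => ‖S (basis H i)‖ ^ 2) :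
    IsSchatten 2 (ContinuousLinearMap.adjoint S ∘L S) := by
  rw [IsSchatten, CFC.abs_of_nonneg _ (isPositive_adjoint_comp S)]
  have hsa : ContinuousLinearMap.adjoint (ContinuousLinearMap.adjoint S ∘L S) =
      ContinuousLinearMap.adjoint S ∘L S := by
    rw [ContinuousLinearMap.adjoint_comp, ContinuousLinearMap.adjoint_adjoint]
  have e : ∀ i, (⟪basis H i, ((ContinuousLinearMap.adjoint S ∘L S) ^ 2) (basis H i)⟫_ℂ).re =
      ‖(ContinuousLinearMap.adjoint S) (S (basis H i))‖ ^ 2 := by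
    intro i
    rw [sq (ContinuousLinearMap.adjoint S ∘L S), mul_apply_eq_comp,
      ← ContinuousLinearMap.adjoint_inner_left, hsa, inner_self_eq_norm_sq_to_K]
    norm_cast
  simp only [e]
  refine Summable.of_nonneg_of_le (fun _ => by positivity) (fun i => ?_)
    (hS.mul_left (‖ContinuousLinearMap.adjoint S‖ ^ 2))
  rw [← mul_pow]
  gcongr
  exact ContinuousLinearMap.le_opNorm _ _

/-- The hypotheses under which `±S*S` is an admissible state above or below a projection `P`. -/
structure IsTrial (P : H →L[ℂ] H) (S : H →L[ℂ] K) : Prop where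
  star_eq : star P = P
  mul_self : P * P = P
  comp_eq : S ∘L P = S
  norm_le : ∀ f, ‖S f‖ ≤ ‖f‖
  summable : Summable fun i => ‖S (basis H i)‖ ^ 2

variable {P : H →L[ℂ] H} {S : H →L[ℂ] K}

theorem IsTrial.adjoint_comp_mul (h : IsTrial P S) :
    (ContinuousLinearMap.adjoint S ∘L S) * P = ContinuousLinearMap.adjoint S ∘L S := by
  change (ContinuousLinearMap.adjoint S ∘L S) ∘L P = _
  rw [ContinuousLinearMap.comp_assoc, h.comp_eq]

theorem IsTrial.mul_adjoint_comp (h : IsTrial P S) :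
    P * (ContinuousLinearMap.adjoint S ∘L S) = ContinuousLinearMap.adjoint S ∘L S := by
  have e : P ∘L ContinuousLinearMap.adjoint S = ContinuousLinearMap.adjoint S := by
    conv_rhs => rw [← h.comp_eq, ContinuousLinearMap.adjoint_comp,
      ← ContinuousLinearMap.star_eq_adjoint, h.star_eq]
  change P ∘L (ContinuousLinearMap.adjoint S ∘L S) = _
  rw [← ContinuousLinearMap.comp_assoc, e]

theorem IsTrial.one_sub_nonneg (h : IsTrial P S) : 0 ≤ 1 - P := by
  have e : 1 - P = star (1 - P) * (1 - P) := by
    rw [star_sub, star_one, h.star_eq, sub_mul, one_mul, mul_sub, mul_one, h.mul_self, sub_self,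
      sub_zero]
  rw [e]
  exact star_mul_self_nonneg _

/-- Because `S = SP` is a contraction, `‖Sf‖ = ‖SPf‖ ≤ ‖Pf‖`, and `‖Pf‖²` is the quadratic form of
the projection `P`. -/
theorem IsTrial.le (h : IsTrial P S) : ContinuousLinearMap.adjoint S ∘L S ≤ P := by
  have hP : ∀ f, ⟪P f, f⟫_ℂ = ((‖P f‖ ^ 2 : ℝ) : ℂ) := by
    intro f
    have e1 : ⟪P f, P f⟫_ℂ = ⟪f, P (P f)⟫_ℂ := by
      conv_rhs => rw [← ContinuousLinearMap.adjoint_inner_left,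
        ← ContinuousLinearMap.star_eq_adjoint, h.star_eq]
    have e2 : P (P f) = P f := congrArg (fun A => A f) h.mul_self
    have e3 : ⟪f, P f⟫_ℂ = ((‖P f‖ ^ 2 : ℝ) : ℂ) := by
      rw [← e2, ← e1, e2, inner_self_eq_norm_sq_to_K]; simp
    rw [← inner_conj_symm, e3, Complex.conj_ofReal]
  rw [ContinuousLinearMap.le_def]
  refine ⟨?_, fun f => ?_⟩
  · refine (IsSelfAdjoint.sub h.star_eq ?_).isSymmetric
    rw [IsSelfAdjoint, ContinuousLinearMap.star_eq_adjoint, ContinuousLinearMap.adjoint_comp,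
      ContinuousLinearMap.adjoint_adjoint]
  · have e1 : ⟪(ContinuousLinearMap.adjoint S ∘L S) f, f⟫_ℂ = ((‖S f‖ ^ 2 : ℝ) : ℂ) := by
      rw [ContinuousLinearMap.comp_apply, ContinuousLinearMap.adjoint_inner_left,
        inner_self_eq_norm_sq_to_K]
      simp
    have e2 : ‖S f‖ ≤ ‖P f‖ := by
      conv_lhs => rw [← h.comp_eq]
      exact h.norm_le _
    rw [ContinuousLinearMap.reApplyInnerSelf_apply, _root_.sub_apply, inner_sub_left, hP, e1,
      ← Complex.ofReal_sub]
    simp only [RCLike.re_to_complex, Complex.ofReal_re]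
    have := norm_nonneg (S f)
    nlinarith

/-- `S*S` lives on the range of `P`: one diagonal block is `S*S` itself and the other is zero, so
the trace-class conditions reduce to the one for `S*S`. -/
theorem IsTrial.mem_convexSet_one_sub (h : IsTrial P S) :
    ContinuousLinearMap.adjoint S ∘L S ∈ convexSet (1 - P) := by
  have h1 := isSchatten_one_adjoint_comp h.summable
  have hz : (1 - P) * (ContinuousLinearMap.adjoint S ∘L S) = 0 := by
    rw [sub_mul, one_mul, h.mul_adjoint_comp, sub_self]
  refine ⟨⟨isSchatten_two_adjoint_comp h.summable, ?_, ?_⟩,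
    (isPositive_adjoint_comp S).isSelfAdjoint, ?_, ?_⟩
  · rwa [sub_sub_cancel, h.mul_adjoint_comp, h.adjoint_comp_mul]
  · rw [hz, zero_mul]
    exact isSchatten_one_zero
  · exact (neg_nonpos.2 h.one_sub_nonneg).trans (isPositive_adjoint_comp S)
  · rw [sub_sub_cancel]
    exact h.le

theorem IsTrial.neg_mem_convexSet (h : IsTrial P S) :
    -(ContinuousLinearMap.adjoint S ∘L S) ∈ convexSet P := by
  have h1 := isSchatten_one_adjoint_comp h.summable
  have hz : (1 - P) * (ContinuousLinearMap.adjoint S ∘L S) = 0 := by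
    rw [sub_mul, one_mul, h.mul_adjoint_comp, sub_self]
  refine ⟨⟨isSchatten_neg (isSchatten_two_adjoint_comp h.summable), ?_, ?_⟩,
    (isPositive_adjoint_comp S).isSelfAdjoint.neg, ?_, ?_⟩
  · rw [mul_neg, hz, neg_zero, zero_mul]
    exact isSchatten_one_zero
  · rw [mul_neg, h.mul_adjoint_comp, neg_mul, h.adjoint_comp_mul]
    exact isSchatten_neg h1
  · exact neg_le_neg h.le
  · exact (neg_nonpos.2 (isPositive_adjoint_comp S)).trans h.one_sub_nonneg

theorem IsTrial.genTrace_one_sub (h : IsTrial P S) {D : H →L[ℂ] H} (hD : D * P = P * D) :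
    genTrace (1 - P) (D * (ContinuousLinearMap.adjoint S ∘L S)) =
      trace (D * (ContinuousLinearMap.adjoint S ∘L S)) := by
  set T := ContinuousLinearMap.adjoint S ∘L S with hT
  have e1 : P * (D * T) * P = D * T := by
    rw [← mul_assoc, ← hD, mul_assoc D, h.mul_adjoint_comp, mul_assoc, h.adjoint_comp_mul]
  have e2 : (1 - P) * (D * T) * (1 - P) = 0 := by
    have : D * T * (1 - P) = 0 := by
      rw [mul_sub, mul_one, mul_assoc, h.adjoint_comp_mul, sub_self]
    rw [mul_assoc, this, mul_zero]
  rw [genTrace, sub_sub_cancel, e1, e2, add_zero]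

theorem IsTrial.genTrace_neg (h : IsTrial P S) {D : H →L[ℂ] H} (hD : D * P = P * D) :
    genTrace P (D * -(ContinuousLinearMap.adjoint S ∘L S)) =
      -trace (D * (ContinuousLinearMap.adjoint S ∘L S)) := by
  have h1 := h.genTrace_one_sub hD
  rw [genTrace, sub_sub_cancel, add_comm] at h1
  rw [← h1, genTrace, trace, trace, ← tsum_neg]
  congr 1
  ext i
  rw [← inner_neg_right]
  congr 1
  simp only [mul_neg, neg_mul]
  rw [← neg_add]
  rfl

/-- Electrons: `S*S` is a state above the sea `P' = 1 - P`. -/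
theorem IsTrial.electron (h : IsTrial P S) {P' D : H →L[ℂ] H} (hP : P' = 1 - P)
    (hD : D * P = P * D) {c : ℝ} (hc : ‖trace (D * (ContinuousLinearMap.adjoint S ∘L S))‖ ≤ c) :
    ContinuousLinearMap.adjoint S ∘L S ∈ convexSet P' ∧
      (genTrace P' (D * (ContinuousLinearMap.adjoint S ∘L S))).re ≤ c := by
  subst hP
  refine ⟨h.mem_convexSet_one_sub, ?_⟩
  rw [h.genTrace_one_sub hD]
  exact (Complex.re_le_norm _).trans hc

/-- Positrons: `-S*S` is a state below the sea `P' = P`. -/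
theorem IsTrial.positron (h : IsTrial P S) {P' D : H →L[ℂ] H} (hP : P' = P)
    (hD : D * P = P * D) {c : ℝ} (hc : ‖trace (D * (ContinuousLinearMap.adjoint S ∘L S))‖ ≤ c) :
    -(ContinuousLinearMap.adjoint S ∘L S) ∈ convexSet P' ∧
      (genTrace P' (D * -(ContinuousLinearMap.adjoint S ∘L S))).re ≤ c := by
  subst hP
  refine ⟨h.neg_mem_convexSet, ?_⟩
  rw [h.genTrace_neg hD]
  refine (Complex.re_le_norm _).trans ?_
  rwa [norm_neg]

/-- Each diagonal entry equals `⟪S D eᵢ, S eᵢ⟫`, and `xy ≤ (x² + y²)/2`. Only Hilbert-Schmidt sums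
remain, so no cyclicity of the trace is needed. -/
theorem norm_trace_mul_adjoint_comp_le {D : H →L[ℂ] H} (hD : star D = D) {a b : ℝ}
    (ha : Summable fun i => ‖S (D (basis H i))‖ ^ 2) (ha' : ∑' i, ‖S (D (basis H i))‖ ^ 2 ≤ a)
    (hb : Summable fun i => ‖S (basis H i)‖ ^ 2) (hb' : ∑' i, ‖S (basis H i)‖ ^ 2 ≤ b) :
    ‖trace (D * (ContinuousLinearMap.adjoint S ∘L S))‖ ≤ (a + b) / 2 := by
  have hs : HasSum (fun i => (‖S (D (basis H i))‖ ^ 2 + ‖S (basis H i)‖ ^ 2) / 2)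
      ((∑' i, ‖S (D (basis H i))‖ ^ 2 + ∑' i, ‖S (basis H i)‖ ^ 2) / 2) :=
    (ha.hasSum.add hb.hasSum).div_const 2
  refine (tsum_of_norm_bounded hs fun i => ?_).trans (by linarith)
  have e : ⟪basis H i, (D * (ContinuousLinearMap.adjoint S ∘L S)) (basis H i)⟫_ℂ =
      ⟪S (D (basis H i)), S (basis H i)⟫_ℂ := by
    rw [mul_apply_eq_comp, ← ContinuousLinearMap.adjoint_inner_left,
      ← ContinuousLinearMap.star_eq_adjoint, hD, ContinuousLinearMap.comp_apply,
      ContinuousLinearMap.adjoint_inner_right]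
  rw [e]
  refine (norm_inner_le_norm _ _).trans ?_
  nlinarith [sq_nonneg (‖S (D (basis H i))‖ - ‖S (basis H i)‖)]

/-- Bessel's inequality for the vector `A*v`. -/
theorem sum_norm_sq_inner_apply_le (A : H →L[ℂ] H) (v : H) (F : Finset (basisSet H)) :
    ∑ i ∈ F, ‖⟪v, A (basis H i)⟫_ℂ‖ ^ 2 ≤ ‖A‖ ^ 2 * ‖v‖ ^ 2 := by
  have e : ∀ i, ‖⟪v, A (basis H i)⟫_ℂ‖ =
      ‖⟪basis H i, ContinuousLinearMap.adjoint A v⟫_ℂ‖ := fun i => by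
    rw [ContinuousLinearMap.adjoint_inner_right, norm_inner_symm]
  simp only [e]
  refine ((basis H).orthonormal.sum_inner_products_le _).trans ?_
  rw [← mul_pow]
  gcongr
  refine (ContinuousLinearMap.le_opNorm _ _).trans_eq ?_
  rw [LinearIsometryEquiv.norm_map]

end Trial

/-! ### Localization operators and their densities -/

/-- Multiplication by a bounded real function on `L²(ℝ³, ℂ⁴)`. -/
def mulOp (s : R3 → ℝ) (hs : MemLp (fun x => (s x : ℂ)) ∞ (volume : Measure R3)) : L2 →L[ℂ] L2 :=
  (ContinuousLinearMap.lsmul ℂ ℂ : ℂ →L[ℂ] Spinor →L[ℂ] Spinor).holderL volume ∞ 2 2 (hs.toLp _)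

theorem mulOp_ae (s : R3 → ℝ) (hs : MemLp (fun x => (s x : ℂ)) ∞ (volume : Measure R3)) (f : L2) :
    mulOp s hs f =ᵐ[volume] fun x => (s x : ℂ) • f x := by
  filter_upwards [ContinuousLinearMap.coeFn_holder (r := 2)
    (ContinuousLinearMap.lsmul ℂ ℂ : ℂ →L[ℂ] Spinor →L[ℂ] Spinor) (hs.toLp _) f,
    hs.coeFn_toLp] with x h1 h2
  change ((ContinuousLinearMap.lsmul ℂ ℂ : ℂ →L[ℂ] Spinor →L[ℂ] Spinor).holder 2 (hs.toLp _) f : L2) x = _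
  rw [h1, h2]
  rfl

theorem norm_sq_eq_integral (f : L2) : ‖f‖ ^ 2 = ∫ x, ‖f x‖ ^ 2 := by
  have h : ((‖f‖ ^ 2 : ℝ) : ℂ) = ⟪f, f⟫_ℂ := by rw [inner_self_eq_norm_sq_to_K]; simp
  rw [L2.inner_def] at h
  have h2 : ∀ x, ⟪f x, f x⟫_ℂ = ((‖f x‖ ^ 2 : ℝ) : ℂ) := fun x => by
    rw [inner_self_eq_norm_sq_to_K]; simp
  simp only [h2] at h
  rw [integral_complex_ofReal] at h
  exact_mod_cast h

theorem integrable_norm_sq (f : L2) : Integrable fun x => ‖f x‖ ^ 2 :=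
  (memLp_two_iff_integrable_sq_norm (Lp.aestronglyMeasurable f)).1 (Lp.memLp f)

theorem norm_sq_ae_eq (Λ : ℝ) (g : cutoffSpace Λ) :
    ∀ᵐ x : R3, ‖(g : L2) x‖ ^ 2 = ∑ k, ‖⟪bandDelta Λ x k, g⟫_ℂ‖ ^ 2 := by
  filter_upwards [ae_all_iff.2 (inner_bandDelta Λ g)] with x hx
  rw [EuclideanSpace.norm_sq_eq]
  simp only [hx]

theorem integrable_sum_inner_bandDelta (Λ : ℝ) (g : cutoffSpace Λ) :
    Integrable fun x : R3 => ∑ k, ‖⟪bandDelta Λ x k, g⟫_ℂ‖ ^ 2 :=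
  (integrable_norm_sq (g : L2)).congr (norm_sq_ae_eq Λ g)

theorem integral_sum_inner_bandDelta (Λ : ℝ) (g : cutoffSpace Λ) :
    ∫ x : R3, ∑ k, ‖⟪bandDelta Λ x k, g⟫_ℂ‖ ^ 2 = ‖g‖ ^ 2 := by
  rw [← integral_congr_ae (norm_sq_ae_eq Λ g), ← norm_sq_eq_integral]
  rfl

theorem fourier_bandDelta (Λ : ℝ) (x : R3) (j : Fin 4) :
    (𝓕 (bandDelta Λ x j : L2) : L2) =ᵐ[volume] (momentumBall Λ).indicator fun ξ : R3 =>
      Complex.exp (-(2 * Real.pi * ⟪ξ, x⟫_ℝ : ℝ) * Complex.I) • EuclideanSpace.single j (1 : ℂ) := by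
  have h : (𝓕 (bandDelta Λ x j : L2) : L2) = (memLp_planeWave Λ x j).toLp _ :=
    (Lp.fourierTransformₗᵢ R3 Spinor).apply_symm_apply _
  rw [h]
  exact (memLp_planeWave Λ x j).coeFn_toLp

/-- Plancherel; plane waves have modulus one, so the result does not depend on `x`. -/
theorem norm_sq_multOp_bandDelta (Λ : ℝ) (m : Sym) (x : R3) (j : Fin 4) :
    ‖multOp Λ m (bandDelta Λ x j)‖ ^ 2 =
      ∫ ξ in momentumBall Λ, ‖m ((2 * Real.pi) • ξ) (EuclideanSpace.single j 1)‖ ^ 2 := by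
  have h : ‖multOp Λ m (bandDelta Λ x j)‖ ^ 2 =
      ‖(𝓕 (multOp Λ m (bandDelta Λ x j) : L2) : L2)‖ ^ 2 := by
    rw [Lp.norm_fourier_eq, Submodule.coe_norm]
  rw [h, norm_sq_eq_integral, ← integral_indicator (measurableSet_momentumBall Λ)]
  apply integral_congr_ae
  filter_upwards [fourier_multOp Λ m (bandDelta Λ x j), fourier_bandDelta Λ x j] with ξ h1 h2
  rw [h1, h2]
  by_cases h3 : ξ ∈ momentumBall Λ
  · simp only [Set.indicator_of_mem h3]
    rw [map_smul, norm_smul, ← Complex.ofReal_neg, Complex.norm_exp_ofReal_mul_I, one_mul]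
  · simp [Set.indicator_of_notMem h3]

theorem norm_sq_bandDelta (Λ : ℝ) (x : R3) (j : Fin 4) :
    ‖bandDelta Λ x j‖ ^ 2 = volume.real (momentumBall Λ) := by
  have h := norm_sq_multOp_bandDelta Λ 1 x j
  rw [multOp_one] at h
  change ‖bandDelta Λ x j‖ ^ 2 = _ at h
  rw [h]
  simp

theorem inner_bandDelta_multOp (Λ : ℝ) (m : Sym) (x y : R3) (j k : Fin 4) :
    ⟪bandDelta Λ y k, multOp Λ m (bandDelta Λ x j)⟫_ℂ =
      ∫ ξ in momentumBall Λ, Complex.exp ((2 * Real.pi * ⟪ξ, y - x⟫_ℝ : ℝ) * Complex.I) *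
        ⟪(EuclideanSpace.single k 1 : Spinor),
          m ((2 * Real.pi) • ξ) (EuclideanSpace.single j 1)⟫_ℂ := by
  rw [inner_eq_integral_fourier, ← integral_indicator (measurableSet_momentumBall Λ)]
  apply integral_congr_ae
  filter_upwards [fourier_multOp Λ m (bandDelta Λ x j), fourier_bandDelta Λ x j,
    fourier_bandDelta Λ y k] with ξ h1 h2 h3
  rw [h1, h2, h3]
  by_cases h : ξ ∈ momentumBall Λ
  · simp only [Set.indicator_of_mem h]
    rw [map_smul, inner_smul_left, inner_smul_right, ← mul_assoc]
    congr 1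
    rw [← Complex.exp_conj, ← Complex.exp_add, inner_sub_right]
    congr 1
    simp only [map_mul, map_neg, Complex.conj_ofReal, Complex.conj_I]
    push_cast
    ring
  · simp [Set.indicator_of_notMem h]

/-- The density profile of a Fourier multiplier: the squared norm of its convolution kernel. -/
def profile (Λ : ℝ) (m : Sym) (z : R3) : ℝ :=
  ∑ j, ∑ k, ‖⟪bandDelta Λ 0 k, multOp Λ m (bandDelta Λ z j)⟫_ℂ‖ ^ 2

theorem profile_nonneg (Λ : ℝ) (m : Sym) (z : R3) : 0 ≤ profile Λ m z := by
  unfold profile; positivity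

/-- Fourier multipliers commute with translations, so only `x - y` enters the kernel. -/
theorem profile_sub (Λ : ℝ) (m : Sym) (x y : R3) :
    ∑ j, ∑ k, ‖⟪bandDelta Λ y k, multOp Λ m (bandDelta Λ x j)⟫_ℂ‖ ^ 2 = profile Λ m (x - y) := by
  simp only [profile, inner_bandDelta_multOp]
  simp

/-- Self-adjointness moves the multiplier onto the fixed `bandDelta` at `0`. As a function of `z`
the inner sum is then the squared modulus of a fixed element of `𝔥_Λ`, which is integrable. -/
theorem profile_eq (Λ : ℝ) {m : Sym} (hm : star m = m) (z : R3) :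
    profile Λ m z =
      ∑ k, ∑ j, ‖⟪bandDelta Λ z j, multOp Λ m (bandDelta Λ 0 k)⟫_ℂ‖ ^ 2 := by
  rw [profile, Finset.sum_comm]
  refine Finset.sum_congr rfl fun k _ => Finset.sum_congr rfl fun j _ => ?_
  have h : star (multOp Λ m) = multOp Λ m := by rw [← multOp_star, hm]
  rw [ContinuousLinearMap.star_eq_adjoint] at h
  rw [← ContinuousLinearMap.adjoint_inner_left, h, norm_inner_symm]

theorem integrable_profile (Λ : ℝ) {m : Sym} (hm : star m = m) : Integrable (profile Λ m) := by
  rw [funext (profile_eq Λ hm)]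
  exact integrable_finsetSum _ fun k _ => integrable_sum_inner_bandDelta Λ _

/-- Integrating in `z` gives the squared norms of the multiplier applied to the four deltas at `0`;
by Plancherel these add up to the integral over the momentum ball of the constant `2`. -/
theorem integral_profile (Λ : ℝ) {m : Sym} (hm : star m = m)
    (ht : ∀ p, ∑ j : Fin 4, ‖m p (EuclideanSpace.single j 1)‖ ^ 2 = 2) :
    ∫ z, profile Λ m z = 2 * volume.real (momentumBall Λ) := by
  rw [funext (profile_eq Λ hm),
    integral_finsetSum _ fun k _ => integrable_sum_inner_bandDelta Λ _]
  simp only [integral_sum_inner_bandDelta, norm_sq_multOp_bandDelta]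
  have hi : ∀ j : Fin 4, IntegrableOn
      (fun ξ => ‖m ((2 * Real.pi) • ξ) (EuclideanSpace.single j 1)‖ ^ 2) (momentumBall Λ) := by
    intro j
    refine ContinuousOn.integrableOn_compact (isCompact_momentumBall Λ) ?_
    have := m.continuous
    fun_prop
  rw [← integral_finsetSum _ fun j _ => hi j]
  simp only [ht]
  simp [mul_comm]

theorem volume_momentumBall {Λ : ℝ} (hΛ : 0 < Λ) :
    volume.real (momentumBall Λ) = Λ ^ 3 / (6 * Real.pi ^ 2) := by
  have hπ := Real.pi_pos
  rw [momentumBall_eq, Measure.real, EuclideanSpace.volume_closedBall_fin_three,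
    ENNReal.toReal_mul, ENNReal.toReal_pow, ENNReal.toReal_ofReal (by positivity),
    ENNReal.toReal_ofReal (by positivity)]
  field_simp
  ring

/-- The localization operator `f ↦ s · m(-i∇) f` from `𝔥_Λ` to `L²`. -/
def localOp (Λ : ℝ) (m : Sym) (s : R3 → ℝ)
    (hs : MemLp (fun x => (s x : ℂ)) ∞ (volume : Measure R3)) : cutoffSpace Λ →L[ℂ] L2 :=
  mulOp s hs ∘L (cutoffSpace Λ).subtypeL ∘L multOp Λ m

section Local

variable {Λ : ℝ} {m : Sym} {s : R3 → ℝ} {hs : MemLp (fun x => (s x : ℂ)) ∞ (volume : Measure R3)}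

theorem norm_sq_localOp_ae (g : cutoffSpace Λ) :
    ∀ᵐ x : R3, ‖localOp Λ m s hs g x‖ ^ 2 =
      s x ^ 2 * ∑ k, ‖⟪bandDelta Λ x k, multOp Λ m g⟫_ℂ‖ ^ 2 := by
  filter_upwards [mulOp_ae s hs (multOp Λ m g : L2), norm_sq_ae_eq Λ (multOp Λ m g)] with x h1 h2
  rw [← h2, ← sq_abs (s x), ← Real.norm_eq_abs, ← Complex.norm_real, ← mul_pow, ← norm_smul, ← h1]
  rfl

theorem norm_sq_localOp (g : cutoffSpace Λ) :
    ‖localOp Λ m s hs g‖ ^ 2 =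
      ∫ x, s x ^ 2 * ∑ k, ‖⟪bandDelta Λ x k, multOp Λ m g⟫_ℂ‖ ^ 2 := by
  rw [norm_sq_eq_integral]
  exact integral_congr_ae (norm_sq_localOp_ae g)

theorem integrable_localOp (m : Sym)
    (hs : MemLp (fun x => (s x : ℂ)) ∞ (volume : Measure R3)) (g : cutoffSpace Λ) :
    Integrable fun x => s x ^ 2 * ∑ k, ‖⟪bandDelta Λ x k, multOp Λ m g⟫_ℂ‖ ^ 2 :=
  (integrable_norm_sq (localOp Λ m s hs g)).congr (norm_sq_localOp_ae g)

theorem localOp_comp (hm : m * m = m) : localOp Λ m s hs ∘L multOp Λ m = localOp Λ m s hs := by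
  have h : multOp Λ m ∘L multOp Λ m = multOp Λ m := by
    change multOp Λ m * multOp Λ m = _
    rw [← multOp_mul, hm]
  rw [localOp, ContinuousLinearMap.comp_assoc, ContinuousLinearMap.comp_assoc, h]

theorem norm_multOp_le (hm : star m = m) (hm2 : m * m = m) (g : cutoffSpace Λ) :
    ‖multOp Λ m g‖ ≤ ‖g‖ := by
  have h : star (multOp Λ m) = multOp Λ m := by rw [← multOp_star, hm]
  rw [ContinuousLinearMap.star_eq_adjoint] at h
  have h2 : multOp Λ m (multOp Λ m g) = multOp Λ m g := by
    conv_rhs => rw [← hm2, multOp_mul]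
    rfl
  have h3 : ⟪g, multOp Λ m g⟫_ℂ = ((‖multOp Λ m g‖ ^ 2 : ℝ) : ℂ) := by
    rw [← h2, ← ContinuousLinearMap.adjoint_inner_left, h, h2, inner_self_eq_norm_sq_to_K]
    simp
  have h4 := norm_inner_le_norm (𝕜 := ℂ) g (multOp Λ m g)
  rw [h3, Complex.norm_real, Real.norm_of_nonneg (by positivity)] at h4
  by_contra! hlt
  nlinarith [norm_nonneg g, norm_nonneg (multOp Λ m g)]

theorem norm_localOp_le (hm : star m = m) (hm2 : m * m = m) (hs1 : ∀ x, |s x| ≤ 1)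
    (g : cutoffSpace Λ) : ‖localOp Λ m s hs g‖ ≤ ‖g‖ := by
  refine le_trans ?_ (norm_multOp_le hm hm2 g)
  refine le_of_sq_le_sq ?_ (norm_nonneg _)
  rw [norm_sq_localOp, ← integral_sum_inner_bandDelta]
  refine integral_mono (integrable_localOp m hs g) (integrable_sum_inner_bandDelta Λ _) fun x => ?_
  refine mul_le_of_le_one_left (by positivity) ?_
  rw [← sq_abs]
  exact pow_le_one₀ (abs_nonneg _) (hs1 x)

/-- Point evaluations are inner products with `bandDelta`, so Bessel applies at each fixed `x`
before integrating against `s²`. The factor `4` counts spinor components, and the volume is the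
squared norm of `bandDelta`. -/
theorem sum_norm_sq_localOp_le (A : Op Λ) (hs2 : Integrable fun x => s x ^ 2)
    (F : Finset (basisSet (cutoffSpace Λ))) :
    ∑ i ∈ F, ‖localOp Λ m s hs (A (basis (cutoffSpace Λ) i))‖ ^ 2 ≤
      4 * ‖multOp Λ m * A‖ ^ 2 * volume.real (momentumBall Λ) * ∫ x, s x ^ 2 := by
  simp only [norm_sq_localOp]
  rw [← integral_finsetSum _ fun i _ => integrable_localOp m hs _, ← integral_const_mul]
  refine integral_mono (integrable_finsetSum _ fun i _ => integrable_localOp m hs _)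
    (hs2.const_mul _) fun x => ?_
  simp only
  rw [← Finset.mul_sum, Finset.sum_comm, mul_comm]
  refine mul_le_mul_of_nonneg_right ?_ (sq_nonneg _)
  have h : ∀ k : Fin 4, ∑ i ∈ F, ‖⟪bandDelta Λ x k, multOp Λ m (A (basis (cutoffSpace Λ) i))⟫_ℂ‖ ^ 2 ≤
      ‖multOp Λ m * A‖ ^ 2 * volume.real (momentumBall Λ) := by
    intro k
    rw [← norm_sq_bandDelta Λ x k]
    exact sum_norm_sq_inner_apply_le (multOp Λ m * A) (bandDelta Λ x k) F
  refine (Finset.sum_le_sum fun k _ => h k).trans_eq ?_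
  simp
  ring

theorem summable_norm_sq_localOp (A : Op Λ) (hs2 : Integrable fun x => s x ^ 2) :
    Summable fun i => ‖localOp Λ m s hs (A (basis (cutoffSpace Λ) i))‖ ^ 2 :=
  summable_of_sum_le (fun _ => by positivity) (sum_norm_sq_localOp_le A hs2)

theorem tsum_norm_sq_localOp_le (A : Op Λ) (hs2 : Integrable fun x => s x ^ 2) :
    ∑' i, ‖localOp Λ m s hs (A (basis (cutoffSpace Λ) i))‖ ^ 2 ≤
      4 * ‖multOp Λ m * A‖ ^ 2 * volume.real (momentumBall Λ) * ∫ x, s x ^ 2 :=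
  (summable_norm_sq_localOp A hs2).tsum_le_of_sum_le (sum_norm_sq_localOp_le A hs2)

theorem isTrial_localOp (hm : star m = m) (hm2 : m * m = m) (hs1 : ∀ x, |s x| ≤ 1)
    (hs2 : Integrable fun x => s x ^ 2) : IsTrial (multOp Λ m) (localOp Λ m s hs) where
  star_eq := by rw [← multOp_star, hm]
  mul_self := by rw [← multOp_mul, hm2]
  comp_eq := localOp_comp hm2
  norm_le := norm_localOp_le hm hm2 hs1
  summable := summable_norm_sq_localOp 1 hs2

/-- The diagonal kernel entries are `‖S(δ_x ⊗ e_j)‖²`; their sum is `s²` integrated against the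
squared kernel of the multiplier. -/
theorem density_localOp (x : R3) :
    density (ContinuousLinearMap.adjoint (localOp Λ m s hs) ∘L localOp Λ m s hs) x =
      ((∫ y, s y ^ 2 * profile Λ m (x - y) : ℝ) : ℂ) := by
  have e : ∀ j, ⟪bandDelta Λ x j,
      (ContinuousLinearMap.adjoint (localOp Λ m s hs) ∘L localOp Λ m s hs) (bandDelta Λ x j)⟫_ℂ =
      ((‖localOp Λ m s hs (bandDelta Λ x j)‖ ^ 2 : ℝ) : ℂ) := by
    intro j
    rw [ContinuousLinearMap.comp_apply, ContinuousLinearMap.adjoint_inner_right,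
      inner_self_eq_norm_sq_to_K]
    simp
  simp only [density, kernel, Matrix.trace, Matrix.diag_apply, Matrix.of_apply, e]
  rw [← Complex.ofReal_sum]
  congr 1
  simp only [norm_sq_localOp]
  rw [← integral_finsetSum _ fun i _ => integrable_localOp m hs _]
  simp only [← Finset.mul_sum, profile_sub]

theorem density_neg (Q : Op Λ) (x : R3) : density (-Q) x = -density Q x := by
  simp [density, kernel, Matrix.trace]

end Local

/-! ### Fourier transform and Coulomb form of integrable functions -/

/-- The unnormalized Fourier transform `∫ f(x) e^{-ik·x} dx`. -/
def ft (f : R3 → ℂ) (k : R3) : ℂ := ∫ x, f x * Complex.exp (-(⟪k, x⟫_ℝ : ℝ) * Complex.I)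

theorem ft_eq_fourierIntegral (f : R3 → ℂ) :
    ft f = VectorFourier.fourierIntegral Real.probChar volume (innerₗ R3) f := by
  ext k
  rw [VectorFourier.fourierIntegral_probChar]
  simp only [ft, innerₗ_apply_apply, smul_eq_mul, mul_comm, real_inner_comm]

/-- The normalization constant `(2π)^{-3/2}`. -/
def ftConst : ℝ := (2 * Real.pi) ^ (-(3 / 2) : ℝ)

theorem ftConst_pos : 0 < ftConst := by unfold ftConst; positivity

theorem hat_eq (f : R3 → ℂ) : hat f = fun k => (ftConst : ℂ) * ft f k := rfl

theorem continuous_ft {f : R3 → ℂ} (hf : Integrable f) : Continuous (ft f) := by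
  rw [ft_eq_fourierIntegral]
  exact VectorFourier.fourierIntegral_continuous Real.continuous_probChar continuous_inner hf

theorem norm_ft_le (f : R3 → ℂ) (k : R3) : ‖ft f k‖ ≤ ∫ x, ‖f x‖ := by
  rw [ft_eq_fourierIntegral]
  exact VectorFourier.norm_fourierIntegral_le_integral_norm _ _ _ _ _

theorem ft_zero (f : R3 → ℂ) : ft f 0 = ∫ x, f x := by simp [ft]

theorem integral_ft_mul {f g : R3 → ℂ} (hf : Integrable f) (hg : Integrable g) :
    ∫ k, ft f k * g k = ∫ x, f x * ft g x := by
  have h := VectorFourier.integral_fourierIntegral_smul_eq_flip (L := innerₗ R3)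
    Real.continuous_probChar (continuous_inner (𝕜 := ℝ) (E := R3)) hf hg
  rw [flip_innerₗ] at h
  simpa only [← ft_eq_fourierIntegral, smul_eq_mul] using h

theorem isFourierTransform_hat {f : R3 → ℂ} (hf : Integrable f) :
    IsFourierTransform f (hat f) := by
  have hc : ∀ {g : R3 → ℂ}, Integrable g → Continuous (hat g) := fun hg => by
    rw [hat_eq]
    exact continuous_const.mul (continuous_ft hg)
  have hb : ∀ (g : R3 → ℂ) k, ‖hat g k‖ ≤ ftConst * ∫ x, ‖g x‖ := fun g k => by
    rw [hat_eq, norm_mul, Complex.norm_real, Real.norm_of_nonneg ftConst_pos.le]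
    exact mul_le_mul_of_nonneg_left (norm_ft_le g k) ftConst_pos.le
  refine ⟨hf.aestronglyMeasurable, (hc hf).aestronglyMeasurable, fun φ => ⟨?_, ?_, ?_⟩⟩
  · exact hf.mul_bdd (c := ftConst * ∫ x, ‖φ x‖) (hc φ.integrable).aestronglyMeasurable
      (ae_of_all _ (hb φ))
  · exact φ.integrable.bdd_mul (c := ftConst * ∫ x, ‖f x‖) (hc hf).aestronglyMeasurable
      (ae_of_all _ (hb f))
  · have h := integral_ft_mul hf (φ.integrable (μ := volume))
    simp only [hat_eq, mul_assoc, mul_left_comm _ (ftConst : ℂ), integral_const_mul, h]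

/-- Test against a smooth bump equal to `1` on a ball around the given point. -/
theorem IsFourierTransform.locallyIntegrable {f g : R3 → ℂ} (h : IsFourierTransform f g) :
    LocallyIntegrable g := by
  intro x
  let χ : ContDiffBump x := ⟨1, 2, one_pos, one_lt_two⟩
  have hs' : HasCompactSupport (fun x => (χ x : ℂ)) :=
    χ.hasCompactSupport.comp_left (g := fun x : ℝ => (x : ℂ)) (by simp)
  have hg' : ContDiff ℝ (⊤ : ℕ∞) (fun x => (χ x : ℂ)) := Complex.ofRealCLM.contDiff.comp χ.contDiff
  have hi : Integrable fun k => g k * (χ k : ℂ) := (h.2.2 (hs'.toSchwartzMap hg')).2.1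
  refine ⟨Metric.closedBall x 1, Metric.closedBall_mem_nhds x one_pos, ?_⟩
  refine hi.integrableOn.congr_fun (fun k hk => ?_) Metric.isClosed_closedBall.measurableSet
  simp [χ.one_of_mem_closedBall hk]

/-- Both functions have the same integrals against smooth compactly supported functions. Hence the
value chosen in `fourierFun` is immaterial, and for integrable functions it may be replaced by the
integral formula. -/
theorem IsFourierTransform.ae_eq {f g₁ g₂ : R3 → ℂ} (h₁ : IsFourierTransform f g₁)
    (h₂ : IsFourierTransform f g₂) : g₁ =ᵐ[volume] g₂ := by
  refine ae_eq_of_integral_contDiff_smul_eq h₁.locallyIntegrable h₂.locallyIntegrable ?_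
  intro g hg hs
  have hs' : HasCompactSupport (fun x => (g x : ℂ)) := hs.comp_left (g := fun x : ℝ => (x : ℂ)) (by simp)
  have hg' : ContDiff ℝ (⊤ : ℕ∞) (fun x => (g x : ℂ)) := Complex.ofRealCLM.contDiff.comp hg
  have e := ((h₁.2.2 (hs'.toSchwartzMap hg')).2.2).trans ((h₂.2.2 (hs'.toSchwartzMap hg')).2.2).symm
  have hφx : ∀ x, (hs'.toSchwartzMap hg') x = (g x : ℂ) := fun x => rfl
  simp only [hφx] at e
  simpa only [Complex.real_smul, mul_comm] using e

theorem fourierFun_ae_eq {f : R3 → ℂ} (hf : Integrable f) : fourierFun f =ᵐ[volume] hat f := by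
  have h : ∃ g, IsFourierTransform f g := ⟨_, isFourierTransform_hat hf⟩
  rw [fourierFun, dif_pos h]
  exact h.choose_spec.ae_eq (isFourierTransform_hat hf)

theorem coulomb_eq {f g : R3 → ℂ} (hf : Integrable f) (hg : Integrable g) :
    coulomb f g = ∫ k, hat f k * (starRingEnd ℂ) (hat g k) / (‖k‖ ^ 2 : ℝ) := by
  apply integral_congr_ae
  filter_upwards [fourierFun_ae_eq hf, fourierFun_ae_eq hg] with k h1 h2
  rw [h1, h2]

open scoped Convolution in
theorem ofReal_convolution (f w : R3 → ℝ) (x : R3) :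
    ((∫ y, f y * w (x - y) : ℝ) : ℂ) =
      ((fun x => (f x : ℂ)) ⋆[ContinuousLinearMap.mul ℂ ℂ, volume] (fun x => (w x : ℂ))) x := by
  rw [convolution, ← integral_complex_ofReal]
  simp

theorem integrable_ofReal_convolution {f w : R3 → ℝ} (hf : Integrable f) (hw : Integrable w) :
    Integrable fun x => ((∫ y, f y * w (x - y) : ℝ) : ℂ) := by
  simp only [ofReal_convolution]
  exact Integrable.integrable_convolution _ hf.ofReal hw.ofReal

theorem ft_convolution {f w : R3 → ℝ} (hf : Integrable f) (hw : Integrable w) (k : R3) :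
    ft (fun x => ((∫ y, f y * w (x - y) : ℝ) : ℂ)) k =
      ft (fun x => (f x : ℂ)) k * ft (fun x => (w x : ℂ)) k := by
  have hc : Continuous fun x : R3 => Complex.exp (-(⟪k, x⟫_ℝ : ℝ) * Complex.I) := by fun_prop
  have hb : ∀ x : R3, ‖Complex.exp (-(⟪k, x⟫_ℝ : ℝ) * Complex.I)‖ ≤ 1 := fun x => by
    rw [← Complex.ofReal_neg, Complex.norm_exp_ofReal_mul_I]
  have h1 : ∀ {f : R3 → ℝ}, Integrable f →
      Integrable fun x => (f x : ℂ) * Complex.exp (-(⟪k, x⟫_ℝ : ℝ) * Complex.I) := fun hf =>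
    hf.ofReal.mul_bdd (c := 1) hc.aestronglyMeasurable (ae_of_all _ hb)
  have h := integral_convolution (ContinuousLinearMap.mul ℂ ℂ) (h1 hf) (h1 hw)
  rw [ContinuousLinearMap.mul_apply'] at h
  rw [ft, ft, ft, ← h]
  congr 1
  ext x
  rw [convolution, ← integral_complex_ofReal, ← integral_mul_const]
  congr 1
  ext y
  rw [ContinuousLinearMap.mul_apply', mul_mul_mul_comm, ← Complex.exp_add, inner_sub_right]
  push_cast
  congr 2
  ring

/-! ### Coulomb energies of smeared Gaussians -/

/-- The Gaussian of width `R`. -/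
def gauss (R : ℝ) (x : R3) : ℝ := Real.exp (-(‖x‖ ^ 2 / (2 * R ^ 2)))

theorem integrable_gauss {R : ℝ} (hR : 0 < R) : Integrable (gauss R) := by
  have h := GaussianFourier.integrable_cexp_neg_mul_sq_norm_add (V := R3)
    (b := ((1 / (2 * R ^ 2) : ℝ) : ℂ)) (by rw [Complex.ofReal_re]; positivity) 0 0
  refine (h.norm).congr (ae_of_all _ fun x => ?_)
  simp only [Complex.norm_exp, gauss]
  congr 1
  simp [← Complex.ofReal_pow, ← Complex.ofReal_mul]
  ring

theorem ft_gauss {R : ℝ} (hR : 0 < R) (k : R3) :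
    ft (fun x => (gauss R x : ℂ)) k =
      ((R ^ 3 * (2 * Real.pi) ^ (3 / 2 : ℝ) * Real.exp (-(R ^ 2 / 2 * ‖k‖ ^ 2)) : ℝ) : ℂ) := by
  have h := GaussianFourier.integral_cexp_neg_mul_sq_norm_add (V := R3)
    (b := ((1 / (2 * R ^ 2) : ℝ) : ℂ)) (by rw [Complex.ofReal_re]; positivity) (-Complex.I) k
  have e : ft (fun x => (gauss R x : ℂ)) k = ∫ v : R3, Complex.exp
      (-((1 / (2 * R ^ 2) : ℝ) : ℂ) * ‖v‖ ^ 2 + -Complex.I * ⟪k, v⟫_ℝ) := by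
    rw [ft]
    congr 1
    ext x
    rw [gauss, Complex.ofReal_exp, ← Complex.exp_add]
    congr 1
    push_cast
    ring
  rw [e, h]
  have hπ := Real.pi_pos
  have e2 : (Real.pi / ((1 / (2 * R ^ 2) : ℝ) : ℂ)) ^ ((Module.finrank ℝ R3 : ℂ) / 2) =
      ((R ^ 3 * (2 * Real.pi) ^ (3 / 2 : ℝ) : ℝ) : ℂ) := by
    rw [← Complex.ofReal_div, finrank_euclideanSpace_fin]
    have : (((3 : ℕ) : ℂ) / 2) = ((3 / 2 : ℝ) : ℂ) := by push_cast; rfl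
    rw [this, ← Complex.ofReal_cpow (by positivity)]
    congr 1
    have : Real.pi / (1 / (2 * R ^ 2)) = R ^ 2 * (2 * Real.pi) := by field_simp
    rw [this, Real.mul_rpow (by positivity) (by positivity), ← Real.rpow_natCast R 2,
      ← Real.rpow_mul hR.le, ← Real.rpow_natCast R 3]
    norm_num
  rw [e2, Complex.ofReal_mul _ (Real.exp _), Complex.ofReal_exp]
  congr 2
  have : (R : ℂ) ≠ 0 := by exact_mod_cast hR.ne'
  push_cast
  rw [neg_sq, Complex.I_sq]
  field_simp
  norm_num

theorem ftConst_mul : ftConst * (2 * Real.pi) ^ (3 / 2 : ℝ) = 1 := by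
  rw [ftConst, ← Real.rpow_add (by positivity)]
  norm_num

theorem integrable_gauss_div_sq {b : ℝ} (hb : 0 < b) :
    Integrable fun k : R3 => Real.exp (-(b * ‖k‖ ^ 2)) / ‖k‖ ^ 2 := by
  rw [integrable_fun_norm_addHaar (volume : Measure R3)
    (f := fun r : ℝ => Real.exp (-(b * r ^ 2)) / r ^ 2), finrank_euclideanSpace_fin]
  refine IntegrableOn.congr_fun (f := fun r : ℝ => Real.exp (-b * r ^ 2))
    (integrable_exp_neg_mul_sq hb).integrableOn (fun r hr => ?_) measurableSet_Ioi
  have : r ≠ 0 := (Set.mem_Ioi.1 hr).ne'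
  simp only [smul_eq_mul, neg_mul]
  field_simp

/-- In polar coordinates the Jacobian `r²` cancels the singularity, leaving `4π` times a half-line
Gaussian integral. -/
theorem integral_gauss_div_sq (b : ℝ) :
    ∫ k : R3, Real.exp (-(b * ‖k‖ ^ 2)) / ‖k‖ ^ 2 = 2 * Real.pi * √(Real.pi / b) := by
  rw [integral_fun_norm_addHaar (volume : Measure R3)
    (fun r : ℝ => Real.exp (-(b * r ^ 2)) / r ^ 2), finrank_euclideanSpace_fin]
  have e : ∫ r in Set.Ioi (0 : ℝ), r ^ (3 - 1) • (Real.exp (-(b * r ^ 2)) / r ^ 2) =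
      √(Real.pi / b) / 2 := by
    rw [← integral_gaussian_Ioi]
    refine setIntegral_congr_fun measurableSet_Ioi fun r hr => ?_
    have : r ≠ 0 := (Set.mem_Ioi.1 hr).ne'
    simp only [smul_eq_mul, neg_mul]
    field_simp
  rw [e, Measure.real, EuclideanSpace.volume_ball_fin_three, ENNReal.toReal_mul,
    ENNReal.toReal_pow, ENNReal.toReal_ofReal zero_le_one, ENNReal.toReal_ofReal (by positivity)]
  simp only [nsmul_eq_mul, smul_eq_mul]
  push_cast
  ring

section Coulomb

variable {w : R3 → ℝ} {R : ℝ}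

/-- The convolution of the Gaussian of width `R` with a real profile `w`. -/
def smear (R : ℝ) (w : R3 → ℝ) (x : R3) : ℂ := ((∫ y, gauss R y * w (x - y) : ℝ) : ℂ)

theorem integrable_smear (hw : Integrable w) (hR : 0 < R) : Integrable (smear R w) :=
  integrable_ofReal_convolution (integrable_gauss hR) hw

theorem hat_smear (hw : Integrable w) (hR : 0 < R) (k : R3) :
    hat (smear R w) k =
      ((R ^ 3 * Real.exp (-(R ^ 2 / 2 * ‖k‖ ^ 2)) : ℝ) : ℂ) * ft (fun x => (w x : ℂ)) k := by
  have e : smear R w = fun x => ((∫ y, gauss R y * w (x - y) : ℝ) : ℂ) := rfl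
  rw [hat_eq, e]
  simp only
  rw [ft_convolution (integrable_gauss hR) hw, ft_gauss hR, ← mul_assoc,
    ← Complex.ofReal_mul]
  congr 2
  linear_combination (R ^ 3 * Real.exp (-(R ^ 2 / 2 * ‖k‖ ^ 2))) * ftConst_mul

/-- Bound the transform of `w` by its `L¹` norm. The Gaussian contributes `R⁶` through its squared
mass, and the integral of its transform against `|k|⁻²` contributes `R⁻¹`. -/
theorem coulomb_smear_self_le (hw : Integrable w) (hR : 0 < R) :
    (coulomb (smear R w) (smear R w)).re ≤
      R ^ 5 * (∫ x, |w x|) ^ 2 * (2 * Real.pi * √Real.pi) := by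
  refine (Complex.re_le_norm _).trans ?_
  rw [coulomb_eq (integrable_smear hw hR) (integrable_smear hw hR)]
  have hR2 : 0 < R ^ 2 := by positivity
  have e : R ^ 5 * (∫ x, |w x|) ^ 2 * (2 * Real.pi * √Real.pi) =
      ∫ k : R3, R ^ 6 * (∫ x, |w x|) ^ 2 * (Real.exp (-(R ^ 2 * ‖k‖ ^ 2)) / ‖k‖ ^ 2) := by
    rw [integral_const_mul, integral_gauss_div_sq, Real.sqrt_div Real.pi_pos.le,
      Real.sqrt_sq hR.le]
    field_simp
  rw [e]
  refine norm_integral_le_of_norm_le ((integrable_gauss_div_sq hR2).const_mul _)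
    (ae_of_all _ fun k => ?_)
  have hb : ‖ft (fun x => (w x : ℂ)) k‖ ≤ ∫ x, |w x| := by
    simpa [Complex.norm_real] using norm_ft_le (fun x => (w x : ℂ)) k
  have hexp : Real.exp (-(R ^ 2 * ‖k‖ ^ 2)) = Real.exp (-(R ^ 2 / 2 * ‖k‖ ^ 2)) ^ 2 := by
    rw [← Real.exp_nat_mul]
    congr 1
    push_cast
    ring
  rw [hat_smear hw hR, norm_div, norm_mul, RCLike.norm_conj, norm_mul, Complex.norm_real,
    Complex.norm_real, Real.norm_of_nonneg (by positivity), Real.norm_of_nonneg (by positivity),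
    hexp, ← mul_div_assoc]
  refine div_le_div_of_nonneg_right ?_ (by positivity)
  calc _ = R ^ 6 * Real.exp (-(R ^ 2 / 2 * ‖k‖ ^ 2)) ^ 2 * ‖ft (fun x => (w x : ℂ)) k‖ ^ 2 := by ring
    _ ≤ R ^ 6 * Real.exp (-(R ^ 2 / 2 * ‖k‖ ^ 2)) ^ 2 * (∫ x, |w x|) ^ 2 := by gcongr
    _ = _ := by ring

/-- The rescaled Coulomb attraction between a smeared profile and a density `ν`. -/
def attraction (w ν : R3 → ℝ) (R : ℝ) : ℂ :=
  ftConst * ∫ u : R3, ((Real.exp (-(1 / 2 * ‖u‖ ^ 2)) / ‖u‖ ^ 2 : ℝ) : ℂ) *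
    (ft (fun x => (w x : ℂ)) (R⁻¹ • u) * (starRingEnd ℂ) (ft (fun x => (ν x : ℂ)) (R⁻¹ • u)))

theorem coulomb_smear (hw : Integrable w) {ν : R3 → ℝ} (hν : Integrable ν) (hR : 0 < R) (Z : ℝ) :
    coulomb (smear R w) (fun x => ((Z * ν x : ℝ) : ℂ)) =
      ((Z * R ^ 2 : ℝ) : ℂ) * attraction w ν R := by
  have hZ : Integrable fun x => ((Z * ν x : ℝ) : ℂ) := (hν.const_mul Z).ofReal
  rw [coulomb_eq (integrable_smear hw hR) hZ]
  set F : R3 → ℂ := fun u => ((Real.exp (-(1 / 2 * ‖u‖ ^ 2)) / ‖u‖ ^ 2 : ℝ) : ℂ) *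
    (ft (fun x => (w x : ℂ)) (R⁻¹ • u) * (starRingEnd ℂ) (ft (fun x => (ν x : ℂ)) (R⁻¹ • u))) with hF
  have hft : ∀ k, ft (fun x => ((Z * ν x : ℝ) : ℂ)) k = Z * ft (fun x => (ν x : ℂ)) k := by
    intro k
    rw [ft, ft, ← integral_const_mul]
    congr 1
    ext x
    push_cast
    ring
  -- Substitution `u = Rk`: the Gaussian mass gives `R³` and `|k|⁻²` gives `R²`; the Jacobian `R⁻³`
  -- later leaves `R²`.
  have e : ∀ k, hat (smear R w) k * (starRingEnd ℂ) (hat (fun x => ((Z * ν x : ℝ) : ℂ)) k) /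
      (‖k‖ ^ 2 : ℝ) = ((ftConst * Z * R ^ 5 : ℝ) : ℂ) * F (R • k) := by
    intro k
    rw [hat_smear hw hR, hat_eq]
    simp only [hft, hF]
    rw [inv_smul_smul₀ hR.ne', norm_smul, Real.norm_of_nonneg hR.le]
    have h1 : R ^ 2 / 2 * ‖k‖ ^ 2 = 1 / 2 * (R * ‖k‖) ^ 2 := by ring
    have hRC : (R : ℂ) ≠ 0 := by exact_mod_cast hR.ne'
    rw [h1]
    simp only [map_mul, Complex.conj_ofReal]
    push_cast
    by_cases hk : (‖k‖ : ℂ) = 0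
    · simp [hk]
    · field_simp
  simp only [e]
  rw [integral_const_mul, Measure.integral_comp_smul, finrank_euclideanSpace_fin, attraction, ← hF,
    abs_of_nonneg (by positivity), Complex.real_smul]
  have hRC : (R : ℂ) ≠ 0 := by exact_mod_cast hR.ne'
  push_cast
  field_simp

/-- As `R → ∞` both transforms are evaluated near `0`, where they equal the total masses. Dominated
convergence applies because they are bounded and the Gaussian weight is integrable. -/
theorem tendsto_attraction (hw : Integrable w) {ν : R3 → ℝ} (hν : Integrable ν) :
    Tendsto (attraction w ν) atTop (nhds (((∫ x, w x) * ∫ x, ν x : ℝ) : ℂ)) := by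
  have hlim : (((∫ x, w x) * ∫ x, ν x : ℝ) : ℂ) =
      ftConst * ∫ u : R3, ((Real.exp (-(1 / 2 * ‖u‖ ^ 2)) / ‖u‖ ^ 2 : ℝ) : ℂ) *
        (ft (fun x => (w x : ℂ)) 0 * (starRingEnd ℂ) (ft (fun x => (ν x : ℂ)) 0)) := by
    rw [integral_mul_const, integral_complex_ofReal, integral_gauss_div_sq, ft_zero,
      ft_zero, integral_complex_ofReal, integral_complex_ofReal, Complex.conj_ofReal, ← mul_assoc,
      ← Complex.ofReal_mul, ← Complex.ofReal_mul, ← Complex.ofReal_mul]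
    congr 1
    -- The weight integrates to `(2π)^{3/2}`, which the Fourier normalization cancels exactly.
    have h : 2 * Real.pi * √(Real.pi / (1 / 2)) = (2 * Real.pi) ^ (3 / 2 : ℝ) := by
      rw [show (3 / 2 : ℝ) = 1 + 1 / 2 by norm_num, Real.rpow_add (by positivity), Real.rpow_one,
        ← Real.sqrt_eq_rpow]
      congr 2
      ring
    rw [h, ftConst_mul, one_mul]
  rw [hlim]
  refine Tendsto.const_mul _ ?_
  have hcw := continuous_ft hw.ofReal
  have hcν := continuous_ft hν.ofReal
  refine tendsto_integral_filter_of_dominated_convergence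
    (fun u => Real.exp (-(1 / 2 * ‖u‖ ^ 2)) / ‖u‖ ^ 2 * ((∫ x, |w x|) * ∫ x, |ν x|)) ?_ ?_
    ((integrable_gauss_div_sq one_half_pos).mul_const _) ?_
  · refine Eventually.of_forall fun R => ?_
    refine AEStronglyMeasurable.mul
      (integrable_gauss_div_sq one_half_pos).ofReal.aestronglyMeasurable ?_
    refine Continuous.aestronglyMeasurable ?_
    exact (hcw.comp (continuous_const_smul _)).mul
      (Complex.continuous_conj.comp (hcν.comp (continuous_const_smul _)))
  · refine Eventually.of_forall fun R => ae_of_all _ fun u => ?_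
    rw [norm_mul, norm_mul, RCLike.norm_conj, Complex.norm_real,
      Real.norm_of_nonneg (by positivity)]
    have hb : ∀ (g : R3 → ℝ) k, ‖ft (fun x => (g x : ℂ)) k‖ ≤ ∫ x, |g x| := fun g k => by
      simpa [Complex.norm_real] using norm_ft_le (fun x => (g x : ℂ)) k
    gcongr
    · exact hb _ _
    · exact hb _ _
  · refine ae_of_all _ fun u => Tendsto.const_mul _ ?_
    have h0 : Tendsto (fun R : ℝ => R⁻¹ • u) atTop (nhds 0) := by
      have := (tendsto_inv_atTop_zero (𝕜 := ℝ)).smul_const u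
      rwa [zero_smul] at this
    exact ((hcw.tendsto 0).comp h0).mul
      ((Complex.continuous_conj.tendsto _).comp ((hcν.tendsto 0).comp h0))

end Coulomb

/-! ### Energy of the Gaussian trial states -/

theorem memLp_top_gauss (R : ℝ) :
    MemLp (fun x => (gauss R x : ℂ)) ∞ (volume : Measure R3) := by
  have hc : Continuous (gauss R) := by unfold gauss; fun_prop
  refine memLp_top_of_bound (Complex.continuous_ofReal.comp hc).aestronglyMeasurable 1
    (ae_of_all _ fun x => ?_)
  rw [Complex.norm_real, gauss, Real.norm_of_nonneg (Real.exp_pos _).le, Real.exp_le_one_iff,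
    neg_nonpos]
  positivity

theorem gauss_sq (R : ℝ) (x : R3) : gauss (√2 * R) x ^ 2 = gauss R x := by
  rw [gauss, gauss, ← Real.exp_nat_mul]
  congr 1
  rw [mul_pow, Real.sq_sqrt zero_le_two]
  push_cast
  by_cases h : R = 0
  · simp [h]
  · field_simp

theorem integral_gauss {R : ℝ} (hR : 0 < R) :
    ∫ x, gauss R x = R ^ 3 * (2 * Real.pi) ^ (3 / 2 : ℝ) := by
  have h := ft_gauss hR 0
  rw [ft_zero, integral_complex_ofReal] at h
  have h2 := Complex.ofReal_injective h
  simpa using h2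

theorem freeDirac_mul_projSym (Λ ε : ℝ) :
    freeDirac Λ * multOp Λ (projSym ε) = multOp Λ (projSym ε) * freeDirac Λ := by
  rw [freeDirac_eq, ← multOp_mul, ← multOp_mul, diracSym_mul_projSym]

/-- Trial states: electrons (`ε = 1`) or positrons (`ε = -1`) filling all momenta below the cut-off
in a Gaussian region of size `R`. -/
theorem exists_trial (Λ : ℝ) {ε : ℝ} (hε : ε = 1 ∨ ε = -1) :
    ∃ C : ℝ, ∀ R : ℝ, 0 < R → ∃ Q ∈ variationalSet Λ,
      (genTrace (Pminus Λ) (freeDirac Λ * Q)).re ≤ C * R ^ 3 ∧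
      density Q = smear R fun z => ε * profile Λ (projSym ε) z := by
  have hε2 : ε ^ 2 = 1 := by rcases hε with h | h <;> simp [h]
  set m := projSym ε with hm
  set V := volume.real (momentumBall Λ) * (2 * Real.pi) ^ (3 / 2 : ℝ) with hV
  refine ⟨(4 * ‖multOp Λ m * freeDirac Λ‖ ^ 2 * V + 4 * ‖multOp Λ m * 1‖ ^ 2 * V) / 2,
    fun R hR => ?_⟩
  -- The density involves `s²`, so `s` has width `√2 R` to make `s²` the Gaussian of width `R`.
  have hs2 : Integrable fun x => gauss (√2 * R) x ^ 2 := by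
    simpa only [gauss_sq] using integrable_gauss hR
  have hI : ∫ x, gauss (√2 * R) x ^ 2 = R ^ 3 * (2 * Real.pi) ^ (3 / 2 : ℝ) := by
    simp only [gauss_sq, integral_gauss hR]
  have hs1 : ∀ x, |gauss (√2 * R) x| ≤ 1 := fun x => by
    rw [gauss, abs_of_pos (Real.exp_pos _), Real.exp_le_one_iff, neg_nonpos]
    positivity
  set S := localOp Λ m (gauss (√2 * R)) (memLp_top_gauss _) with hS
  have hT : IsTrial (multOp Λ m) S :=
    isTrial_localOp (star_projSym ε) (projSym_mul_self hε2) hs1 hs2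
  have htr : ‖trace (freeDirac Λ * (ContinuousLinearMap.adjoint S ∘L S))‖ ≤
      (4 * ‖multOp Λ m * freeDirac Λ‖ ^ 2 * V + 4 * ‖multOp Λ m * 1‖ ^ 2 * V) / 2 * R ^ 3 := by
    refine (norm_trace_mul_adjoint_comp_le (isSelfAdjoint_freeDirac Λ)
      (summable_norm_sq_localOp _ hs2) (tsum_norm_sq_localOp_le _ hs2)
      (summable_norm_sq_localOp 1 hs2) (tsum_norm_sq_localOp_le 1 hs2)).trans_eq ?_
    rw [hI, hV]
    ring
  have hd : ∀ x, density (ContinuousLinearMap.adjoint S ∘L S) x =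
      ((∫ y, gauss R y * profile Λ m (x - y) : ℝ) : ℂ) := fun x => by
    rw [density_localOp]
    simp only [gauss_sq]
  have hcomm := freeDirac_mul_projSym Λ ε
  rcases hε with rfl | rfl
  · have hP : Pminus Λ = 1 - multOp Λ m := by rw [hm, projSym_one, sub_sub_cancel]
    obtain ⟨h1, h2⟩ := hT.electron hP hcomm htr
    refine ⟨ContinuousLinearMap.adjoint S ∘L S, h1, h2, ?_⟩
    ext x
    rw [hd, smear]
    simp only [one_mul]
  · have hP : Pminus Λ = multOp Λ m := (projSym_neg_one Λ).symm
    obtain ⟨h1, h2⟩ := hT.positron hP hcomm htr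
    refine ⟨-(ContinuousLinearMap.adjoint S ∘L S), h1, h2, ?_⟩
    ext x
    rw [density_neg, hd, smear]
    simp only [neg_mul, one_mul, mul_neg, integral_neg, Complex.ofReal_neg]

/-- Upper bound on the ground state energy, for a trial state of size `R`. -/
theorem exists_energy_le {α Λ : ℝ} (hα : 0 < α) (hΛ : 0 < Λ) {ν : R3 → ℝ} (hν : Integrable ν)
    {ε : ℝ} (hε : ε = 1 ∨ ε = -1) :
    ∃ (C : ℝ) (A : ℝ → ℝ), Tendsto A atTop (nhds (ε * (Λ ^ 3 / (3 * Real.pi ^ 2)) * ∫ x, ν x)) ∧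
      ∀ R : ℝ, 0 < R → ∀ Z : ℝ, groundEnergy α Λ ν Z ≤
        ((C * R ^ 3 - α * (Z * R ^ 2 * A R) +
          α / 2 * (R ^ 5 * (Λ ^ 3 / (3 * Real.pi ^ 2)) ^ 2 * (2 * Real.pi * √Real.pi)) : ℝ) :
            EReal) := by
  have hε2 : ε ^ 2 = 1 := by rcases hε with h | h <;> simp [h]
  have hεa : |ε| = 1 := by rcases hε with h | h <;> simp [h]
  obtain ⟨C, hC⟩ := exists_trial Λ hε
  set w : R3 → ℝ := fun z => ε * profile Λ (projSym ε) z with hw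
  have hp := integrable_profile Λ (star_projSym ε)
  have hwi : Integrable w := hp.const_mul ε
  have hI : ∫ z, profile Λ (projSym ε) z = Λ ^ 3 / (3 * Real.pi ^ 2) := by
    rw [integral_profile Λ (star_projSym ε) (sum_norm_projSym hε2), volume_momentumBall hΛ]
    field_simp
    norm_num
  have hw1 : ∫ z, w z = ε * (Λ ^ 3 / (3 * Real.pi ^ 2)) := by rw [hw, integral_const_mul, hI]
  have hw2 : ∫ z, |w z| = Λ ^ 3 / (3 * Real.pi ^ 2) := by
    simp only [hw, abs_mul, hεa, one_mul, abs_of_nonneg (profile_nonneg _ _ _), hI]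
  refine ⟨C, fun R => (attraction w ν R).re, ?_, fun R hR Z => ?_⟩
  · have h := (Complex.continuous_re.tendsto _).comp (tendsto_attraction hwi hν)
    rwa [Complex.ofReal_re, hw1] at h
  · obtain ⟨Q, hQ, hQ1, hQ2⟩ := hC R hR
    refine (iInf₂_le Q hQ).trans (EReal.coe_le_coe_iff.2 ?_)
    have h1 := coulomb_smear_self_le hwi hR
    rw [hw2] at h1
    rw [energy, hQ2, coulomb_smear hwi hν hR, Complex.re_ofReal_mul]
    gcongr

/-! ### Choice of the length scale and conclusion -/

/-- After cancelling `Λ · 3^{-1/3} π^{-2/3}`, crude bounds suffice: `2^{-23/3} ≤ 1/128`,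
`(3/π)^{2/3} ≤ 1` and `π√π ≤ 8` reduce the claim to `1/128 < 7/128`. -/
theorem constant_bound {Λ : ℝ} (hΛ : 0 < Λ) :
    2 ^ (-(23 / 3) : ℝ) * 3 ^ (1 / 3 : ℝ) * Real.pi ^ (-(4 / 3) : ℝ) * Λ <
      (Λ ^ 3 / (3 * Real.pi ^ 2)) ^ (1 / 3 : ℝ) * (1 / 16 - Real.pi * √Real.pi / 1024) := by
  have hπ := Real.pi_pos
  have e1 : (Λ ^ 3 / (3 * Real.pi ^ 2)) ^ (1 / 3 : ℝ) =
      Λ * (3 ^ (-(1 / 3) : ℝ) * Real.pi ^ (-(2 / 3) : ℝ)) := by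
    rw [Real.div_rpow (by positivity) (by positivity), Real.mul_rpow (by positivity) (by positivity),
      ← Real.rpow_natCast Λ, ← Real.rpow_natCast Real.pi, ← Real.rpow_mul hΛ.le,
      ← Real.rpow_mul hπ.le, Real.rpow_neg (by positivity), Real.rpow_neg (by positivity)]
    norm_num
    field_simp
  have e2 : (3 : ℝ) ^ (1 / 3 : ℝ) = 3 ^ (2 / 3 : ℝ) * 3 ^ (-(1 / 3) : ℝ) := by
    rw [← Real.rpow_add (by norm_num)]; norm_num
  have e3 : Real.pi ^ (-(4 / 3) : ℝ) = Real.pi ^ (-(2 / 3) : ℝ) * Real.pi ^ (-(2 / 3) : ℝ) := by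
    rw [← Real.rpow_add hπ]; norm_num
  have h1 : (2 : ℝ) ^ (-(23 / 3) : ℝ) ≤ 1 / 128 := by
    calc (2 : ℝ) ^ (-(23 / 3) : ℝ) ≤ 2 ^ (-7 : ℝ) :=
          Real.rpow_le_rpow_of_exponent_le (by norm_num) (by norm_num)
      _ = 1 / 128 := by rw [Real.rpow_neg (by norm_num)]; norm_num
  have h2 : (3 : ℝ) ^ (2 / 3 : ℝ) * Real.pi ^ (-(2 / 3) : ℝ) ≤ 1 := by
    rw [Real.rpow_neg hπ.le, ← div_eq_mul_inv]
    refine div_le_one_of_le₀ ?_ (by positivity)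
    exact Real.rpow_le_rpow (by norm_num) Real.pi_gt_three.le (by norm_num)
  have h3 : Real.pi * √Real.pi ≤ 8 := by
    have : √Real.pi ≤ 2 := Real.sqrt_le_iff.2 ⟨by norm_num, by linarith [Real.pi_le_four]⟩
    nlinarith [Real.pi_le_four, Real.sqrt_nonneg Real.pi]
  rw [e1, e2, e3]
  set B := (3 : ℝ) ^ (-(1 / 3) : ℝ) * Real.pi ^ (-(2 / 3) : ℝ) with hB
  have hB0 : 0 < Λ * B := by positivity
  calc _ = 2 ^ (-(23 / 3) : ℝ) * (3 ^ (2 / 3 : ℝ) * Real.pi ^ (-(2 / 3) : ℝ)) * (Λ * B) := by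
        rw [hB]; ring
    _ ≤ 1 / 128 * 1 * (Λ * B) := by gcongr
    _ < (1 / 16 - 8 / 1024) * (Λ * B) := by nlinarith
    _ ≤ (1 / 16 - Real.pi * √Real.pi / 1024) * (Λ * B) := by gcongr
    _ = _ := by ring

end BDF

end

theorem proposition3p1 (α Λ : ℝ) (hα : 0 < α) (hΛ : 0 < Λ) (ν : BDF.R3 → ℝ)
    (hνC : BDF.MemCoulomb fun x => (ν x : ℂ)) (hνL : Integrable ν volume)
    (hν1 : ∫ x, |ν x| = 1) (q : ℝ) (hq : q = ∫ x, ν x) (hq0 : q ≠ 0) :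
    limsup (fun Z : ℝ => BDF.groundEnergy α Λ ν Z / ((Z ^ (5 / 3 : ℝ) : ℝ) : EReal)) atTop ≤
      ((-(2 ^ (-(23 / 3) : ℝ) * 3 ^ (1 / 3 : ℝ) * Real.pi ^ (-(4 / 3) : ℝ)
        * α * Λ * |q| ^ (5 / 3 : ℝ)) : ℝ) : EReal) := by
  have hπ := Real.pi_pos
  -- Particles whose charge has the sign of `q`, so that the Coulomb cross term lowers the energy.
  obtain ⟨ε, hε, hεq⟩ : ∃ ε : ℝ, (ε = 1 ∨ ε = -1) ∧ ε * q = |q| := by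
    rcases lt_or_gt_of_ne hq0 with h | h
    · exact ⟨-1, Or.inr rfl, by rw [abs_of_neg h]; ring⟩
    · exact ⟨1, Or.inl rfl, by rw [abs_of_pos h]; ring⟩
  obtain ⟨C, A, hA, hE⟩ := BDF.exists_energy_le hα hΛ hνL hε
  rw [← hq] at hA
  set ρ := Λ ^ 3 / (3 * Real.pi ^ 2) with hρ
  have hρ0 : 0 < ρ := by positivity
  have hq1 : 0 < |q| := abs_pos.2 hq0
  set u := |q| ^ (1 / 3 : ℝ) with hu
  set v := ρ ^ (1 / 3 : ℝ) with hv
  have hu0 : 0 < u := by positivity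
  have hv0 : 0 < v := by positivity
  have hu3 : u ^ 3 = |q| := by
    rw [hu, ← Real.rpow_natCast, ← Real.rpow_mul hq1.le]; norm_num
  have hu5 : u ^ 5 = |q| ^ (5 / 3 : ℝ) := by
    rw [hu, ← Real.rpow_natCast, ← Real.rpow_mul hq1.le]; norm_num
  have hv3 : v ^ 3 = ρ := by
    rw [hv, ← Real.rpow_natCast, ← Real.rpow_mul hρ0.le]; norm_num
  -- The balance of the two Coulomb terms forces `a` proportional to `(|q|/ρ)^{1/3}`; the factor
  -- `1/4` is convenient rather than optimal, and yields `1/16 = 4⁻²` and `1/1024 = 4⁻⁵`.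
  set a := u / (4 * v) with ha
  have ha0 : 0 < a := by positivity
  -- The energy bound at `R = a Z^{1/3}` divided by `Z^{5/3}`; the kinetic part decays like
  -- `Z^{-2/3}`.
  have hlim : Tendsto (fun Z : ℝ => C * a ^ 3 * Z ^ (-(2 / 3) : ℝ) -
      α * (a ^ 2 * A (a * Z ^ (1 / 3 : ℝ))) +
      α / 2 * (a ^ 5 * ρ ^ 2 * (2 * Real.pi * √Real.pi))) atTop
      (nhds (C * a ^ 3 * 0 - α * (a ^ 2 * (ε * ρ * q)) +
        α / 2 * (a ^ 5 * ρ ^ 2 * (2 * Real.pi * √Real.pi)))) := by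
    have hR : Tendsto (fun Z : ℝ => a * Z ^ (1 / 3 : ℝ)) atTop atTop :=
      (tendsto_rpow_atTop (by norm_num)).const_mul_atTop ha0
    exact (((tendsto_rpow_neg_atTop (by norm_num)).const_mul _).sub
      (((hA.comp hR).const_mul _).const_mul _)).add_const _
  have hlt : C * a ^ 3 * 0 - α * (a ^ 2 * (ε * ρ * q)) +
      α / 2 * (a ^ 5 * ρ ^ 2 * (2 * Real.pi * √Real.pi)) <
      -(2 ^ (-(23 / 3) : ℝ) * 3 ^ (1 / 3 : ℝ) * Real.pi ^ (-(4 / 3) : ℝ)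
        * α * Λ * |q| ^ (5 / 3 : ℝ)) := by
    have h1 := BDF.constant_bound hΛ
    have e1 : ε * ρ * q = u ^ 3 * v ^ 3 := by rw [hu3, hv3, ← hεq]; ring
    have e2 : C * a ^ 3 * 0 - α * (a ^ 2 * (ε * ρ * q)) +
        α / 2 * (a ^ 5 * ρ ^ 2 * (2 * Real.pi * √Real.pi)) =
        -(α * u ^ 5 * (v * (1 / 16 - Real.pi * √Real.pi / 1024))) := by
      rw [e1, ← hv3, ha]
      field_simp
      ring
    rw [e2, ← hu5, neg_lt_neg_iff]
    calc _ = α * u ^ 5 *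
        (2 ^ (-(23 / 3) : ℝ) * 3 ^ (1 / 3 : ℝ) * Real.pi ^ (-(4 / 3) : ℝ) * Λ) := by ring
      _ < _ := mul_lt_mul_of_pos_left h1 (by positivity)
  -- The limit lies strictly below the target, so the quotient is eventually below it, which bounds
  -- the `limsup`.
  refine limsup_le_of_le (by isBoundedDefault) ?_
  filter_upwards [hlim.eventually_lt_const hlt, eventually_gt_atTop (0 : ℝ)] with Z hZ hZ0
  -- Writing `Z = t³` turns all fractional powers into integer powers of `t`.
  set t := Z ^ (1 / 3 : ℝ) with ht
  have ht0 : 0 < t := by positivity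
  have ht3 : Z = t ^ 3 := by
    rw [ht, ← Real.rpow_natCast, ← Real.rpow_mul hZ0.le]; norm_num
  have ht5 : Z ^ (5 / 3 : ℝ) = t ^ 5 := by
    rw [ht, ← Real.rpow_natCast, ← Real.rpow_mul hZ0.le]; norm_num
  have ht2 : Z ^ (-(2 / 3) : ℝ) = (t ^ 2)⁻¹ := by
    rw [ht, ← Real.rpow_natCast, ← Real.rpow_mul hZ0.le, ← Real.rpow_neg hZ0.le]; norm_num
  have hpos : 0 < Z ^ (5 / 3 : ℝ) := by positivity
  refine (EReal.div_le_div_right_of_nonneg (by exact_mod_cast hpos.le)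
    (hE (a * t) (by positivity) Z)).trans ?_
  rw [← EReal.coe_div, EReal.coe_le_coe_iff]
  refine le_trans (le_of_eq ?_) hZ.le
  rw [ht5, ht2]
  nth_rw 1 [ht3]
  field_simp
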